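/- Let $G$ be a connected finite simple graph with vertex set $V$ in which every vertex has degree at least $2$. Write $q_v=\deg(v)-1$ and $q_{\max}=\max_{v}q_v$. Let $E$ be the set of oriented edges $e$ (with initial vertex $\iota(e)$, terminal vertex $\tau(e)$ and reversal $e^{\mathrm{op}}$), write $e\frown e'$ if $\tau(e)=\iota(e')$ and $e\neq (e')^{\mathrm{op}}$, and let $P$ be the set of infinite non-backtracking edge paths $\mathbf p=(e_0\frown e_1\frown e_2\frown\cdots)$. For $\vartheta\in(0,1)$ let $d_\vartheta(\mathbf p,\mathbf p')=\vartheta^{\inf\{j\,:\,e_j\ne e'_j\}}$ (with $\vartheta^{\infty}=0$). Let $\mathcal F_\vartheta$ be the space of bounded functions $F:P\to\mathbb C$ that are $d_\vartheta$-Lipschitz, with one common constant, on each set of paths with a common initial vertex, with norm $\|F\|_\vartheta=L_\vartheta(F)+\|F\|_\infty$, where $L_\vartheta(F)$ is the least $C\ge 0$ with $|F(\mathbf p)-F(\mathbf p')|\le C\,d_\vartheta(\mathbf p,\mathbf p')$ for all $\mathbf p,\mathbf p'$ with the same first edge. The transfer operator is $$(\mathcal L F)(e_0\frown e_1\frown\cdots)=\sum_{e\,:\,e\frown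 e_0}F(e\frown e_0\frown e_1\frown\cdots).$$ Let $R_m$ be the maximum over $e\in E$ of the number of non-backtracking paths $e_{-m}\frown\cdots\frown e_{-1}\frown e$. For functions on $E$ and on $V$ and $z\in\mathbb C\setminus\{0\}$ put $$(S\varphi)(e)=\sum_{e'\frown e}\varphi(e'),\quad (\Sigma f)(v)=\sum_{w\sim v}f(w),\quad (N_zf)(v)=(z+q_vz^{-1})f(v),$$ $$(\Delta f)(v)=\frac{1}{1+q_v}\sum_{w\sim v}f(w),\quad (M_zf)(v)=\frac{z+z^{-1}q_v}{1+q_v}f(v).$$ Then there is a real number $\rho$, depending only on $G$, with $\rho=\lim_{m\to\infty}R_m^{1/m}$ and $\rho\le q_{\max}$, with equality if and only if $G$ is regular, such that for every $\vartheta\in(0,1)$: 1. $\mathcal L$ restricts to a bounded operator $\mathcal L_\vartheta$ on $\mathcal F_\vartheta$, whose spectral radius is $\rho=\lim_{m\to\infty}\|\mathcal L_\vartheta^m\|_{\mathrm{op}}^{1/m}$. 2. Every $\lambda$ in the spectrum of $\mathcal L_\vartheta$ with $|\lambda|>\vartheta\rho$ is an eigenvalue of finite (algebraic) multiplicity, i.e.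 $\bigcup_k\ker(\mathcal L_\vartheta-\lambda)^k$ is finite-dimensional. 3. For every such $\lambda$, the eigenspace $\mathcal E_\lambda=\ker(\mathcal L_\vartheta-\lambda)$ is contained in the space $D_1$ of functions that depend only on the first edge of the path, and $\varphi\mapsto\big(\mathbf p\mapsto\varphi(e_0)\big)$ is a linear isomorphism from $\ker(S-\lambda)$ onto $\mathcal E_\lambda$. 4. For every such $\lambda$ with $\lambda\ne\pm1$, the space $\{f:\Sigma f=N_\lambda f\}$ is isomorphic to $\mathcal E_\lambda$, an isomorphism being $f\mapsto\big(\mathbf p\mapsto f(\iota(e_0))-\lambda^{-1}f(\tau(e_0))\big)$. Moreover $\{f:\Sigma f=N_\lambda f\}=\{f:\Delta f=M_\lambda f\}$. -/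

import Mathlib

namespace SpectralGraph

/-- Two oriented edges form a turn: the second starts where the first ends, and the first is not
the reversal of the second. -/
def Turn {V : Type*} {G : SimpleGraph V} (e e' : G.Dart) : Prop :=
  e.snd = e'.fst ∧ e ≠ e'.symm

instance {V : Type*} [DecidableEq V] {G : SimpleGraph V} (e e' : G.Dart) :
    Decidable (Turn e e') :=
  inferInstanceAs (Decidable (_ ∧ _))

/-- Infinite edge paths without backtracking; the first edge has index `0`. -/
def EdgePath {V : Type*} (G : SimpleGraph V) : Type _ :=
  {p : ℕ → G.Dart // ∀ i, Turn (p i) (p (i + 1))}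

/-- The `i`-th edge of a path. -/
def EdgePath.edge {V : Type*} {G : SimpleGraph V} (p : EdgePath G) (i : ℕ) : G.Dart := p.1 i

/-- The one-turn extension `e ⌢ p` of the path `p`. -/
def EdgePath.cons {V : Type*} {G : SimpleGraph V} (e : G.Dart) (p : EdgePath G)
    (h : Turn e (p.edge 0)) : EdgePath G :=
  ⟨fun i => Nat.casesOn i e p.1, fun i => by
    cases i with
    | zero => exact h
    | succ j => exact p.2 j⟩

/-! ### Operators on unrestricted function spaces -/

/-- The transfer operator: summation over all one-turn extensions. -/
def transfer {V : Type*} [Fintype V] [DecidableEq V] (G : SimpleGraph V) [DecidableRel G.Adj] :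
    (EdgePath G → ℂ) →ₗ[ℂ] (EdgePath G → ℂ) where
  toFun F p := ∑ e : {e : G.Dart // Turn e (p.edge 0)}, F (p.cons e.1 e.2)
  map_add' F F' := by ext p; simp [Finset.sum_add_distrib]
  map_smul' c F := by ext p; simp [Finset.mul_sum]

/-- The turn sum operator on functions of oriented edges. -/
def turnSum {V : Type*} [Fintype V] [DecidableEq V] (G : SimpleGraph V) [DecidableRel G.Adj] :
    (G.Dart → ℂ) →ₗ[ℂ] (G.Dart → ℂ) where
  toFun φ e := ∑ e' : G.Dart with Turn e' e, φ e'
  map_add' φ φ' := by ext e; simp [Finset.sum_add_distrib]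
  map_smul' c φ := by ext e; simp [Finset.mul_sum]

/-- The neighbor sum operator on functions of vertices. -/
def neighborSum {V : Type*} [Fintype V] (G : SimpleGraph V) [DecidableRel G.Adj] :
    (V → ℂ) →ₗ[ℂ] (V → ℂ) where
  toFun f v := ∑ w ∈ G.neighborFinset v, f w
  map_add' f f' := by ext v; simp [Finset.sum_add_distrib]
  map_smul' c f := by ext v; simp [Finset.mul_sum]

/-- The degree shifted down by one. -/
def modDegree {V : Type*} [Fintype V] (G : SimpleGraph V) [DecidableRel G.Adj] (v : V) : ℕ :=
  G.degree v - 1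

/-- The maximum of the shifted degrees. -/
def maxModDegree {V : Type*} [Fintype V] (G : SimpleGraph V) [DecidableRel G.Adj] : ℕ :=
  Finset.univ.sup (modDegree G)

/-- Multiplication by a fixed function of the vertices. -/
def vertexMul {V : Type*} (a : V → ℂ) : (V → ℂ) →ₗ[ℂ] (V → ℂ) where
  toFun f v := a v * f v
  map_add' f f' := by ext v; simp [mul_add]
  map_smul' c f := by ext v; simp [mul_left_comm]

/-- The twisted rescaling operator: multiplication by `v ↦ z + q_v z⁻¹`. -/
noncomputable def rescale {V : Type*} [Fintype V] (G : SimpleGraph V) [DecidableRel G.Adj]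
    (z : ℂ) : (V → ℂ) →ₗ[ℂ] (V → ℂ) :=
  vertexMul fun v => z + (modDegree G v : ℂ) * z⁻¹

/-- The Laplacian: averaging over the neighbors. -/
noncomputable def neighborAvg {V : Type*} [Fintype V] (G : SimpleGraph V) [DecidableRel G.Adj] :
    (V → ℂ) →ₗ[ℂ] (V → ℂ) :=
  vertexMul (fun v => 1 / (1 + (modDegree G v : ℂ))) ∘ₗ neighborSum G

/-- The rescaling adapted to the Laplacian: multiplication by
`v ↦ (z + z⁻¹ q_v) / (1 + q_v)`. -/
noncomputable def localTweak {V : Type*} [Fintype V] (G : SimpleGraph V) [DecidableRel G.Adj]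
    (z : ℂ) : (V → ℂ) →ₗ[ℂ] (V → ℂ) :=
  vertexMul fun v => (z + z⁻¹ * (modDegree G v : ℂ)) / (1 + (modDegree G v : ℂ))

/-- The twisted gradient of a function of the vertices. -/
noncomputable def gradient {V : Type*} (G : SimpleGraph V) (z : ℂ) (f : V → ℂ) (e : G.Dart) : ℂ :=
  f e.fst - z⁻¹ * f e.snd

/-! ### Path counting -/

/-- The number of non-backtracking paths `e₋ₘ ⌢ ⋯ ⌢ e₋₁ ⌢ e` that end with the edge `e`. -/
noncomputable def pileHeightAt {V : Type*} (G : SimpleGraph V) (m : ℕ) (e : G.Dart) : ℕ :=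
  Nat.card {w : Fin (m + 1) → G.Dart //
    (∀ i : Fin m, Turn (w i.castSucc) (w i.succ)) ∧ w (Fin.last m) = e}

/-- The maximum `R_m` over all edges `e` of the number of paths counted by `pileHeightAt`. -/
noncomputable def pileHeight {V : Type*} [Fintype V] [DecidableEq V] (G : SimpleGraph V)
    [DecidableRel G.Adj] (m : ℕ) : ℕ :=
  Finset.univ.sup (pileHeightAt G m)

/-! ### Lipschitz functions -/

open Classical in
/-- The ultrametric `d_ϑ`: `ϑ` to the power of the first index at which the paths differ. -/
noncomputable def pathDist {V : Type*} {G : SimpleGraph V} (ϑ : ℝ) (p q : EdgePath G) : ℝ :=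
  if p = q then 0 else ϑ ^ sInf {i : ℕ | p.edge i ≠ q.edge i}

/-- `F` is `d_ϑ`-Lipschitz with constant `C` on every island, i.e. on each set of paths with a
common starting vertex. -/
def LipOnIslands {V : Type*} {G : SimpleGraph V} (ϑ C : ℝ) (F : EdgePath G → ℂ) : Prop :=
  ∀ p q : EdgePath G, (p.edge 0).fst = (q.edge 0).fst → ‖F p - F q‖ ≤ C * pathDist ϑ p q

/-- `F` is `d_ϑ`-Lipschitz with constant `C` on every level-one district, i.e. on each set of
paths with a common first edge. -/
def LipOnDistricts {V : Type*} {G : SimpleGraph V} (ϑ C : ℝ) (F : EdgePath G → ℂ) : Prop :=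
  ∀ p q : EdgePath G, p.edge 0 = q.edge 0 → ‖F p - F q‖ ≤ C * pathDist ϑ p q

/-- The bounded functions that are uniformly `d_ϑ`-Lipschitz on islands, as a subspace of all
functions on paths. -/
def lipSubmodule {V : Type*} (G : SimpleGraph V) (ϑ : ℝ) : Submodule ℂ (EdgePath G → ℂ) where
  carrier := {F | (∃ B : ℝ, ∀ p, ‖F p‖ ≤ B) ∧ ∃ C : ℝ, 0 ≤ C ∧ LipOnIslands ϑ C F}
  zero_mem' := ⟨⟨0, fun p => by simp⟩, 0, le_rfl, fun p q _ => by simp⟩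
  add_mem' := by
    rintro F F' ⟨⟨B, hB⟩, C, hC, h⟩ ⟨⟨B', hB'⟩, C', hC', h'⟩
    refine ⟨⟨B + B', fun p => (norm_add_le _ _).trans (add_le_add (hB p) (hB' p))⟩,
      C + C', add_nonneg hC hC', fun p q hpq => ?_⟩
    calc ‖(F + F') p - (F + F') q‖ = ‖(F p - F q) + (F' p - F' q)‖ := by
          simp only [Pi.add_apply]; congr 1; ring
      _ ≤ _ := norm_add_le _ _
      _ ≤ _ := add_le_add (h p q hpq) (h' p q hpq)
      _ = _ := by ring
  smul_mem' := by
    rintro c F ⟨⟨B, hB⟩, C, hC, h⟩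
    refine ⟨⟨‖c‖ * B, fun p => ?_⟩, ‖c‖ * C, mul_nonneg (norm_nonneg c) hC, fun p q hpq => ?_⟩
    · simpa using mul_le_mul_of_nonneg_left (hB p) (norm_nonneg c)
    · calc ‖(c • F) p - (c • F) q‖ = ‖c‖ * ‖F p - F q‖ := by
            simp [← mul_sub]
        _ ≤ ‖c‖ * (C * pathDist ϑ p q) := mul_le_mul_of_nonneg_left (h p q hpq) (norm_nonneg c)
        _ = _ := by ring

/-- The space of `ϑ`-Lipschitz functions. It is a separate type, so that the norm below is its
only topology. -/
def LipMaps {V : Type*} (G : SimpleGraph V) (ϑ : ℝ) : Type _ := ↥(lipSubmodule G ϑ)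

noncomputable instance {V : Type*} (G : SimpleGraph V) (ϑ : ℝ) : AddCommGroup (LipMaps G ϑ) :=
  inferInstanceAs (AddCommGroup ↥(lipSubmodule G ϑ))

noncomputable instance {V : Type*} (G : SimpleGraph V) (ϑ : ℝ) : Module ℂ (LipMaps G ϑ) :=
  inferInstanceAs (Module ℂ ↥(lipSubmodule G ϑ))

/-- The inclusion of the Lipschitz functions into all functions on paths. -/
noncomputable def LipMaps.toFun {V : Type*} {G : SimpleGraph V} {ϑ : ℝ} :
    LipMaps G ϑ →ₗ[ℂ] (EdgePath G → ℂ) :=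
  (lipSubmodule G ϑ).subtype

noncomputable instance {V : Type*} (G : SimpleGraph V) (ϑ : ℝ) :
    CoeFun (LipMaps G ϑ) fun _ => EdgePath G → ℂ :=
  ⟨fun F => LipMaps.toFun F⟩

/-- The optimal Lipschitz constant on level-one districts. -/
noncomputable def lipConst {V : Type*} {G : SimpleGraph V} (ϑ : ℝ) (F : EdgePath G → ℂ) : ℝ :=
  sInf {C : ℝ | 0 ≤ C ∧ LipOnDistricts ϑ C F}

/-- The sup norm of a bounded function. -/
noncomputable def supNorm {V : Type*} {G : SimpleGraph V} (F : EdgePath G → ℂ) : ℝ :=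
  ⨆ p, ‖F p‖

theorem lipConst_nonneg {V : Type*} {G : SimpleGraph V} (ϑ : ℝ) (F : EdgePath G → ℂ) :
    0 ≤ lipConst ϑ F :=
  Real.sInf_nonneg fun _ h => h.1

theorem supNorm_nonneg {V : Type*} {G : SimpleGraph V} (F : EdgePath G → ℂ) : 0 ≤ supNorm F :=
  Real.iSup_nonneg fun _ => norm_nonneg _

theorem lipConst_le {V : Type*} {G : SimpleGraph V} {ϑ C : ℝ} {F : EdgePath G → ℂ}
    (hC : 0 ≤ C) (h : LipOnDistricts ϑ C F) : lipConst ϑ F ≤ C :=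
  csInf_le ⟨0, fun _ h => h.1⟩ ⟨hC, h⟩

theorem LipMaps.le_supNorm {V : Type*} {G : SimpleGraph V} {ϑ : ℝ} (F : LipMaps G ϑ)
    (p : EdgePath G) : ‖F p‖ ≤ supNorm (F : EdgePath G → ℂ) := by
  obtain ⟨B, hB⟩ := F.2.1
  exact le_ciSup (f := fun p => ‖F p‖) ⟨B, by rintro _ ⟨q, rfl⟩; exact hB q⟩ p

theorem LipMaps.lipOnDistricts {V : Type*} {G : SimpleGraph V} {ϑ : ℝ} (F : LipMaps G ϑ) :
    LipOnDistricts ϑ (lipConst ϑ (F : EdgePath G → ℂ)) (F : EdgePath G → ℂ) := by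
  obtain ⟨C, hC, h⟩ := F.2.2
  have hcl : IsClosed {C : ℝ | 0 ≤ C ∧ LipOnDistricts ϑ C (F : EdgePath G → ℂ)} := by
    have : {C : ℝ | 0 ≤ C ∧ LipOnDistricts ϑ C (F : EdgePath G → ℂ)} =
        Set.Ici 0 ∩ ⋂ (p : EdgePath G) (q : EdgePath G) (_ : p.edge 0 = q.edge 0),
          {C : ℝ | ‖F p - F q‖ ≤ C * pathDist ϑ p q} := by
      ext C; simp [LipOnDistricts]
    rw [this]
    refine isClosed_Ici.inter (isClosed_iInter fun p => isClosed_iInter fun q =>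
      isClosed_iInter fun _ => isClosed_le continuous_const (by fun_prop))
  have hne : {C : ℝ | 0 ≤ C ∧ LipOnDistricts ϑ C (F : EdgePath G → ℂ)}.Nonempty :=
    ⟨C, hC, fun p q hpq => h p q (by rw [hpq])⟩
  exact (hcl.csInf_mem hne ⟨0, fun _ h => h.1⟩).2

/-- The norm of a Lipschitz function: optimal Lipschitz constant on level-one districts plus
sup norm. -/
noncomputable instance {V : Type*} (G : SimpleGraph V) (ϑ : ℝ) : Norm (LipMaps G ϑ) :=
  ⟨fun F => lipConst ϑ (F : EdgePath G → ℂ) + supNorm (F : EdgePath G → ℂ)⟩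

theorem LipMaps.norm_def {V : Type*} {G : SimpleGraph V} {ϑ : ℝ} (F : LipMaps G ϑ) :
    ‖F‖ = lipConst ϑ (F : EdgePath G → ℂ) + supNorm (F : EdgePath G → ℂ) := rfl

theorem LipMaps.norm_smul_le' {V : Type*} {G : SimpleGraph V} {ϑ : ℝ} (c : ℂ)
    (F : LipMaps G ϑ) : ‖c • F‖ ≤ ‖c‖ * ‖F‖ := by
  rw [LipMaps.norm_def, LipMaps.norm_def, mul_add]
  refine add_le_add (lipConst_le (mul_nonneg (norm_nonneg c) (lipConst_nonneg _ _)) ?_) ?_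
  · intro p q hpq
    calc ‖(c • F) p - (c • F) q‖ = ‖c‖ * ‖F p - F q‖ := by
          simp [← mul_sub]
      _ ≤ ‖c‖ * (lipConst ϑ (F : EdgePath G → ℂ) * pathDist ϑ p q) :=
          mul_le_mul_of_nonneg_left (F.lipOnDistricts p q hpq) (norm_nonneg c)
      _ = _ := by ring
  · refine Real.iSup_le (fun p => ?_) (mul_nonneg (norm_nonneg c) (supNorm_nonneg _))
    simpa using mul_le_mul_of_nonneg_left (F.le_supNorm p) (norm_nonneg c)

theorem LipMaps.normedSpaceCore {V : Type*} (G : SimpleGraph V) (ϑ : ℝ) :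
    NormedSpace.Core ℂ (LipMaps G ϑ) where
  norm_nonneg F := add_nonneg (lipConst_nonneg _ _) (supNorm_nonneg _)
  norm_smul c F := by
    refine le_antisymm (F.norm_smul_le' c) ?_
    by_cases hc : c = 0
    · subst hc
      rw [norm_zero, zero_mul]
      exact add_nonneg (lipConst_nonneg _ _) (supNorm_nonneg _)
    · have h := LipMaps.norm_smul_le' c⁻¹ (c • F)
      rw [inv_smul_smul₀ hc, norm_inv] at h
      have hc' : 0 < ‖c‖ := norm_pos_iff.mpr hc
      calc ‖c‖ * ‖F‖ ≤ ‖c‖ * (‖c‖⁻¹ * ‖c • F‖) := mul_le_mul_of_nonneg_left h hc'.le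
        _ = ‖c • F‖ := by field_simp
  norm_triangle F F' := by
    have h1 : lipConst ϑ ((F + F' : LipMaps G ϑ) : EdgePath G → ℂ) ≤
        lipConst ϑ (F : EdgePath G → ℂ) + lipConst ϑ (F' : EdgePath G → ℂ) := by
      refine lipConst_le (add_nonneg (lipConst_nonneg _ _) (lipConst_nonneg _ _)) ?_
      intro p q hpq
      calc ‖(F + F') p - (F + F') q‖ = ‖(F p - F q) + (F' p - F' q)‖ := by
            simp only [map_add, Pi.add_apply]; congr 1; ring
        _ ≤ _ := norm_add_le _ _
        _ ≤ _ := add_le_add (F.lipOnDistricts p q hpq) (F'.lipOnDistricts p q hpq)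
        _ = _ := by ring
    have h2 : supNorm ((F + F' : LipMaps G ϑ) : EdgePath G → ℂ) ≤
        supNorm (F : EdgePath G → ℂ) + supNorm (F' : EdgePath G → ℂ) := by
      refine Real.iSup_le (fun p => ?_) (add_nonneg (supNorm_nonneg _) (supNorm_nonneg _))
      simp only [map_add, Pi.add_apply]
      exact (norm_add_le _ _).trans (add_le_add (F.le_supNorm p) (F'.le_supNorm p))
    rw [LipMaps.norm_def, LipMaps.norm_def, LipMaps.norm_def]
    linarith
  norm_eq_zero_iff F := by
    constructor
    · intro h
      rw [LipMaps.norm_def] at h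
      have h0 : supNorm (F : EdgePath G → ℂ) = 0 := by
        have := lipConst_nonneg ϑ (F : EdgePath G → ℂ)
        have := supNorm_nonneg (F : EdgePath G → ℂ)
        linarith
      apply Subtype.ext
      funext p
      have := F.le_supNorm p
      rw [h0] at this
      exact norm_le_zero_iff.mp this
    · rintro rfl
      have h := LipMaps.norm_smul_le' (0 : ℂ) (0 : LipMaps G ϑ)
      rw [smul_zero, norm_zero, zero_mul] at h
      exact le_antisymm h (add_nonneg (lipConst_nonneg _ _) (supNorm_nonneg _))

noncomputable instance {V : Type*} (G : SimpleGraph V) (ϑ : ℝ) :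
    NormedAddCommGroup (LipMaps G ϑ) :=
  NormedAddCommGroup.ofCore (LipMaps.normedSpaceCore G ϑ)

noncomputable instance {V : Type*} (G : SimpleGraph V) (ϑ : ℝ) : NormedSpace ℂ (LipMaps G ϑ) :=
  NormedSpace.ofCore (LipMaps.normedSpaceCore G ϑ)

/-- The subspace of functions that only depend on the first `n` edges of the path. -/
def dependsOn {V : Type*} (G : SimpleGraph V) (ϑ : ℝ) (n : ℕ) : Submodule ℂ (LipMaps G ϑ) where
  carrier := {F | ∀ p q : EdgePath G, (∀ i < n, p.edge i = q.edge i) → F p = F q}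
  zero_mem' := fun p q _ => by simp
  add_mem' := fun {F F'} h h' p q hpq => by
    simp only [map_add, Pi.add_apply]; rw [h p q hpq, h' p q hpq]
  smul_mem' := fun c F h p q hpq => by
    simp only [map_smul, Pi.smul_apply]; rw [h p q hpq]

end SpectralGraph

open Filter Topology SpectralGraph

/-! Write $T$ for the transfer operator, $N_m(e)$ for the number of paths counted by `pileHeightAt`,
and $R_m=\max_e N_m(e)$. Iterating $T$ sums over $N_m(e_0)$ extensions, and prepending a common edge
multiplies distances by $\vartheta$. So the sup norm grows by at most $R_m$ under $T^m$, and the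
Lipschitz constant by at most $R_m\vartheta^m$. The constant function $1$ shows that $\|T^m\|=R_m$
exactly (`norm_lipTransfer_pow`). Gelfand's formula then gives both the limit $\rho$ and the
spectral radius, and spectral mapping gives $\rho^m\le R_m$ for every $m$.

For the discrete spectrum, let $Q$ subtract from $F$ its value at a chosen path with the same first
edge. $Q$ is a projection with kernel in the finite-dimensional space $D_1$. Since $T$ preserves
functions of the first edge, $QTQ=QT$, hence $(QT)^m=QT^m$ for $m\ge1$. $Q$ sees only the Lipschitz
constant, so $\|QT^m\|\le 2R_m\vartheta^m$ and the spectrum of $QT$ lies in the disc of radius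
$\vartheta\rho$. For $\lambda$ outside this disc, invertibility of $\lambda-QT$ forces generalized
eigenvectors into $\ker Q$ and reduces surjectivity of $\lambda-T$ to linear algebra on $\ker Q$.

On functions of the first edge $T$ acts as $S$. Since $(S\varphi)(e)+\varphi(e^{\mathrm{op}})$
depends only on $\iota(e)$, an eigenvector is recovered from a vertex function by a $2\times2$
system of determinant $\lambda^2-1$.

If $\rho=q_{\max}$, then $R_m=q_{\max}^m$ for all $m$. Some edge then has maximal counts for all
$m$, and maximality spreads over the whole graph by double counting and connectedness. -/

namespace SpectralGraph

/-! ### Shifted degrees -/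

section Degrees

variable {V : Type*} [Fintype V] {G : SimpleGraph V} [DecidableRel G.Adj]

theorem modDegree_le_max (v : V) : modDegree G v ≤ maxModDegree G :=
  Finset.le_sup (f := modDegree G) (Finset.mem_univ v)

theorem modDegree_add_one (hdeg : ∀ v, 2 ≤ G.degree v) (v : V) :
    modDegree G v + 1 = G.degree v := by
  have := hdeg v
  unfold modDegree
  omega

theorem nonempty_dart (hconn : G.Connected) (hdeg : ∀ v, 2 ≤ G.degree v) : Nonempty G.Dart := by
  obtain ⟨v⟩ := hconn.nonempty
  obtain ⟨w, hw⟩ := (G.degree_pos_iff_exists_adj v).1 (by have := hdeg v; omega)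
  exact ⟨⟨(v, w), hw⟩⟩

end Degrees

/-! ### Turns and sums over predecessors of an edge -/

section Turns

variable {V : Type*} {G : SimpleGraph V}

theorem turn_symm_iff {e e' : G.Dart} : Turn e'.symm e.symm ↔ Turn e e' := by
  constructor
  · rintro ⟨h, h'⟩
    refine ⟨h.symm, fun h'' => h' ?_⟩
    rw [h'']
    simp
  · rintro ⟨h, h'⟩
    refine ⟨h.symm, fun h'' => h' ?_⟩
    rw [h'']
    simp

variable [Fintype V] [DecidableEq V] [DecidableRel G.Adj]

theorem filter_turn_eq (e : G.Dart) :
    (Finset.univ.filter fun e' : G.Dart => Turn e' e) =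
      (Finset.univ.filter fun e' : G.Dart => e'.snd = e.fst).erase e.symm := by
  ext e'
  simp only [Finset.mem_filter, Finset.mem_univ, true_and, Finset.mem_erase]
  exact and_comm

theorem sum_filter_snd {M : Type*} [AddCommMonoid M] (x : V) (g : V → M) :
    ∑ e : G.Dart with e.snd = x, g e.fst = ∑ w ∈ G.neighborFinset x, g w := by
  refine Finset.sum_bij (fun e _ => e.fst) ?_ ?_ ?_ ?_
  · intro e he
    have he : e.snd = x := by simpa using he
    subst he
    simpa using e.adj.symm
  · intro e he e' he' h
    have he : e.snd = x := by simpa using he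
    have he' : e'.snd = x := by simpa using he'
    exact SimpleGraph.Dart.ext _ _ (Prod.ext h (he.trans he'.symm))
  · intro w hw
    have hw : G.Adj x w := by simpa using hw
    exact ⟨⟨(w, x), hw.symm⟩, by simp, rfl⟩
  · intros; rfl

/-- The predecessors of `e` are all edges ending at its initial vertex except the reversal of `e`.
Adding the reversal back leaves a sum that depends on that vertex alone. -/
theorem sum_turn_add_symm {M : Type*} [AddCommMonoid M] (e : G.Dart) (φ : G.Dart → M) :
    ∑ e' : G.Dart with Turn e' e, φ e' + φ e.symm = ∑ e' : G.Dart with e'.snd = e.fst, φ e' := by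
  rw [filter_turn_eq, Finset.sum_erase_add _ _ (by simp)]

theorem card_turn_left (e : G.Dart) :
    (Finset.univ.filter fun e' : G.Dart => Turn e' e).card = modDegree G e.fst := by
  have h := sum_turn_add_symm (M := ℕ) e fun _ => 1
  have h' := sum_filter_snd (G := G) (M := ℕ) e.fst fun _ => 1
  rw [h', ← Finset.card_eq_sum_ones, ← Finset.card_eq_sum_ones,
    SimpleGraph.card_neighborFinset_eq_degree] at h
  rw [modDegree, ← h, Nat.add_sub_cancel]

theorem card_turn_right (e : G.Dart) :
    (Finset.univ.filter fun e' : G.Dart => Turn e e').card = modDegree G e.snd := by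
  have h := card_turn_left e.symm
  rw [SimpleGraph.Dart.symm_toProd, Prod.fst_swap] at h
  rw [← h]
  refine Finset.card_bij (fun e' _ => e'.symm) ?_ ?_ ?_
  · intro e' he'
    simpa [turn_symm_iff] using he'
  · intro _ _ _ _ h
    exact SimpleGraph.Dart.symm_involutive.injective h
  · intro e' he'
    refine ⟨e'.symm, ?_, by simp⟩
    have : Turn e' e.symm := by simpa using he'
    rw [← turn_symm_iff] at this
    simpa using this

end Turns

/-! ### Path counts and the regularity criterion -/

section Counting

theorem pileHeightAt_zero {V : Type*} (G : SimpleGraph V) (e : G.Dart) : pileHeightAt G 0 e = 1 := by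
  rw [pileHeightAt, Nat.card_eq_one_iff_unique]
  constructor
  · constructor
    rintro ⟨w, -, hw⟩ ⟨w', -, hw'⟩
    refine Subtype.ext (funext fun i => ?_)
    rw [show i = Fin.last 0 from Fin.fin_one_eq_zero i]
    exact hw.trans hw'.symm
  · exact ⟨⟨fun _ => e, fun i => i.elim0, rfl⟩⟩

variable {V : Type*} [Fintype V] [DecidableEq V] (G : SimpleGraph V) [DecidableRel G.Adj]

/-- A path of `m + 1` turns ending in `e` is a turn `e' ⌢ e` together with a path of `m` turns
ending in `e'`. -/
def pathsSuccEquiv (m : ℕ) (e : G.Dart) :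
    {w : Fin (m + 2) → G.Dart //
      (∀ i : Fin (m + 1), Turn (w i.castSucc) (w i.succ)) ∧ w (Fin.last (m + 1)) = e} ≃
    Σ e' : {e' : G.Dart // Turn e' e}, {w : Fin (m + 1) → G.Dart //
      (∀ i : Fin m, Turn (w i.castSucc) (w i.succ)) ∧ w (Fin.last m) = e'.1} where
  toFun w := ⟨⟨w.1 (Fin.last m).castSucc, by
      have h := w.2.1 (Fin.last m)
      rwa [Fin.succ_last, w.2.2] at h⟩,
    ⟨fun i => w.1 i.castSucc, fun i => by
      have := w.2.1 i.castSucc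
      rwa [Fin.succ_castSucc] at this, rfl⟩⟩
  invFun s := ⟨Fin.snoc (α := fun _ => G.Dart) s.2.1 e, fun i => by
      induction i using Fin.lastCases with
      | last =>
        rw [Fin.snoc_castSucc, Fin.succ_last, Fin.snoc_last, s.2.2.2]
        exact s.1.2
      | cast i =>
        rw [Fin.snoc_castSucc, Fin.succ_castSucc, Fin.snoc_castSucc]
        exact s.2.2.1 i, Fin.snoc_last _ _⟩
  left_inv w := by
    refine Subtype.ext (funext fun i => ?_)
    induction i using Fin.lastCases with
    | last => simpa using w.2.2.symm
    | cast i => simp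
  right_inv s := by
    obtain ⟨⟨e', he'⟩, w, hw, hl⟩ := s
    dsimp only at hl
    subst hl
    exact Sigma.subtype_ext (Subtype.ext (by simp)) (funext fun i => by simp)

theorem pileHeightAt_succ (m : ℕ) (e : G.Dart) :
    pileHeightAt G (m + 1) e = ∑ e' : G.Dart with Turn e' e, pileHeightAt G m e' := by
  classical
  rw [pileHeightAt, Nat.card_congr (pathsSuccEquiv G m e), Nat.card_sigma]
  exact (Finset.sum_subtype (Finset.univ.filter fun e' : G.Dart => Turn e' e) (by simp)
    (pileHeightAt G m)).symm

theorem pileHeightAt_one (e : G.Dart) : pileHeightAt G 1 e = modDegree G e.fst := by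
  simp [pileHeightAt_succ, pileHeightAt_zero, card_turn_left]

theorem pileHeightAt_le_pileHeight (m : ℕ) (e : G.Dart) : pileHeightAt G m e ≤ pileHeight G m :=
  Finset.le_sup (f := pileHeightAt G m) (Finset.mem_univ e)

/-- The extra edge is attached at the far end of the path. Hence once a count falls below the power
of the maximum, it stays below. -/
theorem pileHeightAt_succ_le (m : ℕ) (e : G.Dart) :
    pileHeightAt G (m + 1) e ≤ maxModDegree G * pileHeightAt G m e := by
  induction m generalizing e with
  | zero =>
    rw [zero_add, pileHeightAt_one, pileHeightAt_zero, mul_one]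
    exact modDegree_le_max _
  | succ m ih =>
    rw [pileHeightAt_succ, pileHeightAt_succ G m, Finset.mul_sum]
    exact Finset.sum_le_sum fun e' _ => ih e'

theorem pileHeightAt_le_pow (m : ℕ) (e : G.Dart) : pileHeightAt G m e ≤ maxModDegree G ^ m := by
  induction m with
  | zero => simp [pileHeightAt_zero]
  | succ m ih =>
    rw [pow_succ']
    exact (pileHeightAt_succ_le G m e).trans (Nat.mul_le_mul_left _ ih)

theorem pileHeight_le_pow (m : ℕ) : pileHeight G m ≤ maxModDegree G ^ m :=
  Finset.sup_le fun e _ => pileHeightAt_le_pow G m e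

theorem pileHeight_eq_pow_of_isRegular [Nonempty G.Dart] {d : ℕ} (h : G.IsRegularOfDegree d)
    (m : ℕ) : pileHeight G m = maxModDegree G ^ m := by
  have e₀ : G.Dart := Classical.arbitrary _
  have hmod : ∀ v, modDegree G v = d - 1 := fun v => by rw [modDegree, h v]
  have hmax : maxModDegree G = d - 1 :=
    le_antisymm (Finset.sup_le fun v _ => (hmod v).le) (hmod e₀.fst ▸ modDegree_le_max e₀.fst)
  have hat : ∀ m e, pileHeightAt G m e = (d - 1) ^ m := by
    intro m
    induction m with
    | zero => simp [pileHeightAt_zero]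
    | succ m ih =>
      intro e
      rw [pileHeightAt_succ, Finset.sum_congr rfl fun e' _ => ih e', Finset.sum_const,
        card_turn_left, hmod, smul_eq_mul, pow_succ']
  refine le_antisymm (pileHeight_le_pow G m) ?_
  rw [hmax, ← hat m e₀]
  exact pileHeightAt_le_pileHeight G m e₀

/-- If all path counts are maximal, then already the counts at one single edge are. -/
theorem exists_forall_pileHeightAt_eq_pow [Nonempty G.Dart]
    (h : ∀ m, maxModDegree G ^ m ≤ pileHeight G m) :
    ∃ e, ∀ m, pileHeightAt G m e = maxModDegree G ^ m := by
  by_contra! hcon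
  choose k hk using hcon
  have hlt : ∀ e j, pileHeightAt G (k e + j) e < maxModDegree G ^ (k e + j) := by
    intro e j
    induction j with
    | zero => exact lt_of_le_of_ne (pileHeightAt_le_pow G _ e) (hk e)
    | succ j ih =>
      -- Strict inequality propagates only through a positive factor; for factor zero the assumed
      -- deficit is itself impossible.
      rcases Nat.eq_zero_or_pos (maxModDegree G) with h0 | h0
      · have h1 := h 1
        have h2 := hk e
        have h3 := pileHeightAt_le_pow G (k e) e
        rcases Nat.eq_zero_or_pos (k e) with h4 | h4
        · rw [h4, pileHeightAt_zero, pow_zero] at h2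
          exact absurd rfl h2
        · rw [h0, zero_pow h4.ne'] at h2 h3
          omega
      · calc pileHeightAt G (k e + (j + 1)) e
            ≤ maxModDegree G * pileHeightAt G (k e + j) e := pileHeightAt_succ_le G _ e
          _ < maxModDegree G * maxModDegree G ^ (k e + j) := Nat.mul_lt_mul_of_pos_left ih h0
          _ = _ := by rw [← pow_succ']; rfl
  -- At a length beyond every first deficit, all edges are deficient at once, including one that
  -- attains the maximum.
  set M := Finset.univ.sup k
  obtain ⟨e, -, he⟩ := Finset.exists_mem_eq_sup (Finset.univ : Finset G.Dart)
    Finset.univ_nonempty (pileHeightAt G M)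
  have hM : k e ≤ M := Finset.le_sup (f := k) (Finset.mem_univ e)
  have := hlt e (M - k e)
  rw [Nat.add_sub_cancel' hM, ← he] at this
  exact absurd (h M) (not_le.mpr this)

/-- The set `A` of edges with maximal counts for all lengths is nonempty and closed under
predecessors and successors; by connectedness its edges start at every vertex, and each such vertex
has maximal degree. -/
theorem isRegular_of_pow_le_pileHeight [Nonempty G.Dart] (hconn : G.Connected)
    (hdeg : ∀ v, 2 ≤ G.degree v) (h : ∀ m, maxModDegree G ^ m ≤ pileHeight G m) :
    G.IsRegularOfDegree (maxModDegree G + 1) := by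
  classical
  set q := maxModDegree G with hq
  set A : Finset G.Dart := Finset.univ.filter fun e => ∀ m, pileHeightAt G m e = q ^ m with hA
  have memA : ∀ e, e ∈ A ↔ ∀ m, pileHeightAt G m e = q ^ m := fun e => by simp [hA]
  have hdegA : ∀ e ∈ A, modDegree G e.fst = q := fun e he => by
    rw [← pileHeightAt_one, (memA e).1 he 1, pow_one]
  have hpred : ∀ e ∈ A, ∀ e', Turn e' e → e' ∈ A := by
    intro e he e' he'
    rw [memA]
    intro m
    -- A sum of `q` terms, each at most `q ^ m`, equals `q ^ (m + 1)`, so every term is maximal.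
    have hsum : ∑ e' : G.Dart with Turn e' e, pileHeightAt G m e' =
        ∑ e' : G.Dart with Turn e' e, q ^ m := by
      rw [← pileHeightAt_succ, (memA e).1 he, Finset.sum_const, card_turn_left, hdegA e he,
        smul_eq_mul, pow_succ']
    exact (Finset.sum_eq_sum_iff_of_le fun e' _ => pileHeightAt_le_pow G m e').1 hsum e'
      (by simpa using he')
  have hsucc : ∀ e ∈ A, ∀ e', Turn e e' → e' ∈ A := by
    -- Turns inside `A` are counted by their second edge: all `q` predecessors of an element of `A`
    -- lie in `A`. Counted by first edges, each contributes at most `q`, so each must have `q`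
    -- successors in `A`.
    have hcount : ∑ e ∈ A, (A.filter fun e' => Turn e e').card = ∑ e ∈ A, q := by
      have h1 := Finset.sum_card_bipartiteAbove_eq_sum_card_bipartiteBelow
        (s := A) (t := A) (fun e e' : G.Dart => Turn e e')
      unfold Finset.bipartiteAbove Finset.bipartiteBelow at h1
      rw [h1]
      refine Finset.sum_congr rfl fun e he => ?_
      rw [← hdegA e he, ← card_turn_left]
      congr 1
      ext e'
      simpa using hpred e he e'
    have hle : ∀ e ∈ A, (A.filter fun e' => Turn e e').card ≤ q := fun e _ =>
      (Finset.card_le_card (Finset.filter_subset_filter _ (Finset.subset_univ A))).trans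
        ((card_turn_right e).le.trans (modDegree_le_max _))
    intro e he e' he'
    have h2 := (Finset.sum_eq_sum_iff_of_le hle).1 hcount e he
    have h3 := Finset.eq_of_subset_of_card_le
      (Finset.filter_subset_filter (fun e' => Turn e e') (Finset.subset_univ A))
      (by rw [h2, card_turn_right]; exact modDegree_le_max _)
    have h4 : e' ∈ A.filter fun e' => Turn e e' := by rw [h3]; simpa using he'
    exact (Finset.mem_filter.1 h4).1
  have hadj : ∀ x z, G.Adj x z → (∃ e ∈ A, e.fst = x) → ∃ e ∈ A, e.fst = z := by
    rintro _ z hxz ⟨e, he, rfl⟩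
    -- The edge from `z` to the start of `e` is a predecessor of `e` unless it is its reversal; in
    -- that case a successor of `e` starts at `z`.
    by_cases hz : z = e.snd
    · have hcard : 0 < (Finset.univ.filter fun e' : G.Dart => Turn e e').card := by
        have := modDegree_add_one hdeg e.snd
        have := hdeg e.snd
        rw [card_turn_right]
        omega
      obtain ⟨e', he'⟩ := Finset.card_pos.1 hcard
      have he' : Turn e e' := by simpa using he'
      exact ⟨e', hsucc e he e' he', he'.1.symm.trans hz.symm⟩
    · refine ⟨⟨(z, e.fst), hxz.symm⟩, hpred e he _ ⟨rfl, fun h => hz ?_⟩, rfl⟩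
      exact congrArg (fun d : G.Dart => d.fst) h
  obtain ⟨e₀, he₀⟩ := exists_forall_pileHeightAt_eq_pow G h
  intro v
  have hv : ∃ e ∈ A, e.fst = v := by
    have hr := (SimpleGraph.reachable_iff_reflTransGen _ _).1 (hconn.preconnected e₀.fst v)
    induction hr with
    | refl => exact ⟨e₀, (memA e₀).2 he₀, rfl⟩
    | tail _ hab ih => exact hadj _ _ hab ih
  obtain ⟨e, he, rfl⟩ := hv
  rw [← hdegA e he, modDegree_add_one hdeg]

end Counting

/-! ### The path space and its ultrametric -/

section Paths

variable {V : Type*} {G : SimpleGraph V}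

theorem EdgePath.ext {p q : EdgePath G} (h : ∀ i, p.edge i = q.edge i) : p = q :=
  Subtype.ext (funext h)

theorem pathDist_self (ϑ : ℝ) (p : EdgePath G) : pathDist ϑ p p = 0 := if_pos rfl

theorem pathDist_eq_pow (ϑ : ℝ) {p q : EdgePath G} {n : ℕ} (h : ∀ i < n, p.edge i = q.edge i)
    (hn : p.edge n ≠ q.edge n) : pathDist ϑ p q = ϑ ^ n := by
  rw [pathDist, if_neg (fun hpq : p = q => hn (hpq ▸ rfl))]
  congr 1
  refine le_antisymm (Nat.sInf_le hn) (le_csInf ⟨n, hn⟩ fun i hi => ?_)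
  by_contra! hlt
  exact hi (h i hlt)

theorem exists_first_difference {p q : EdgePath G} (hpq : p ≠ q) :
    ∃ n, (∀ i < n, p.edge i = q.edge i) ∧ p.edge n ≠ q.edge n := by
  classical
  have h : ∃ n, p.edge n ≠ q.edge n := by
    by_contra! h
    exact hpq (EdgePath.ext h)
  exact ⟨Nat.find h, fun i hi => not_not.1 (Nat.find_min h hi), Nat.find_spec h⟩

theorem pathDist_of_edge_zero_ne (ϑ : ℝ) {p q : EdgePath G} (h : p.edge 0 ≠ q.edge 0) :
    pathDist ϑ p q = 1 := by
  rw [pathDist_eq_pow ϑ (n := 0) (by simp) h, pow_zero]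

/-- The first difference moves one place to the right. This is the source of all contraction. -/
theorem pathDist_cons (ϑ : ℝ) (e : G.Dart) {p q : EdgePath G} (hp : Turn e (p.edge 0))
    (hq : Turn e (q.edge 0)) : pathDist ϑ (p.cons e hp) (q.cons e hq) = ϑ * pathDist ϑ p q := by
  by_cases hpq : p = q
  · subst hpq
    simp [pathDist_self]
  · obtain ⟨n, hn, hne⟩ := exists_first_difference hpq
    rw [pathDist_eq_pow ϑ hn hne, pathDist_eq_pow ϑ (n := n + 1) _ hne, pow_succ']
    rintro (_ | i) hi
    · rfl
    · exact hn i (by omega)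

theorem pathDist_nonneg {ϑ : ℝ} (h0 : 0 ≤ ϑ) (p q : EdgePath G) : 0 ≤ pathDist ϑ p q := by
  unfold pathDist
  split_ifs
  · exact le_rfl
  · positivity

theorem pathDist_le_one {ϑ : ℝ} (h0 : 0 ≤ ϑ) (h1 : ϑ ≤ 1) (p q : EdgePath G) :
    pathDist ϑ p q ≤ 1 := by
  unfold pathDist
  split_ifs
  · exact zero_le_one
  · exact pow_le_one₀ h0 h1

/-- In a graph of minimal degree at least two, every edge starts an infinite path. -/
theorem exists_edgePath [Fintype V] [DecidableEq V] [DecidableRel G.Adj]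
    (hdeg : ∀ v, 2 ≤ G.degree v) (e : G.Dart) : ∃ p : EdgePath G, p.edge 0 = e := by
  have hnext : ∀ e : G.Dart, ∃ e', Turn e e' := by
    intro e
    have hcard : 0 < (Finset.univ.filter fun e' : G.Dart => Turn e e').card := by
      have := modDegree_add_one hdeg e.snd
      have := hdeg e.snd
      rw [card_turn_right]
      omega
    obtain ⟨e', he'⟩ := Finset.card_pos.1 hcard
    exact ⟨e', by simpa using he'⟩
  choose next hnext using hnext
  refine ⟨⟨fun i => next^[i] e, fun i => ?_⟩, rfl⟩
  dsimp only
  rw [Function.iterate_succ_apply']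
  exact hnext _

end Paths

/-! ### The Banach space of Lipschitz functions -/

section LipMaps

variable {V : Type*} {G : SimpleGraph V} {ϑ : ℝ}

/-- Paths with different first edges have distance 1, so across districts the sup bound serves as a
Lipschitz bound. The maximum with 0 covers an empty path space, where `B` may be negative. -/
theorem mem_lipSubmodule (h0 : 0 ≤ ϑ) {F : EdgePath G → ℂ} {B C : ℝ} (hB : ∀ p, ‖F p‖ ≤ B)
    (hC : LipOnDistricts ϑ C F) : F ∈ lipSubmodule G ϑ := by
  refine ⟨⟨B, hB⟩, max C (2 * max B 0), le_max_of_le_right (by positivity), fun p q _ => ?_⟩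
  by_cases h : p.edge 0 = q.edge 0
  · exact (hC p q h).trans
      (mul_le_mul_of_nonneg_right (le_max_left _ _) (pathDist_nonneg h0 p q))
  · rw [pathDist_of_edge_zero_ne ϑ h, mul_one]
    calc ‖F p - F q‖ ≤ ‖F p‖ + ‖F q‖ := norm_sub_le _ _
      _ ≤ 2 * max B 0 := by
        rw [two_mul]
        exact add_le_add ((hB p).trans (le_max_left _ _)) ((hB q).trans (le_max_left _ _))
      _ ≤ _ := le_max_right _ _

/-- A bounded function that is Lipschitz on districts, as an element of the function space. -/
def LipMaps.mk' (h0 : 0 ≤ ϑ) (F : EdgePath G → ℂ) {B C : ℝ} (hB : ∀ p, ‖F p‖ ≤ B)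
    (hC : LipOnDistricts ϑ C F) : LipMaps G ϑ :=
  ⟨F, mem_lipSubmodule h0 hB hC⟩

@[simp] theorem LipMaps.mk'_apply (h0 : 0 ≤ ϑ) (F : EdgePath G → ℂ) {B C : ℝ}
    (hB : ∀ p, ‖F p‖ ≤ B) (hC : LipOnDistricts ϑ C F) (p : EdgePath G) :
    LipMaps.mk' h0 F hB hC p = F p := rfl

theorem LipMaps.ext {F F' : LipMaps G ϑ} (h : ∀ p, F p = F' p) : F = F' :=
  Subtype.ext (funext h)

theorem LipMaps.norm_le {F : LipMaps G ϑ} {B C : ℝ} (hB0 : 0 ≤ B) (hC0 : 0 ≤ C)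
    (hB : ∀ p, ‖F p‖ ≤ B) (hC : LipOnDistricts ϑ C F) : ‖F‖ ≤ C + B :=
  add_le_add (lipConst_le hC0 hC) (Real.iSup_le hB hB0)

theorem LipMaps.norm_apply_le (F : LipMaps G ϑ) (p : EdgePath G) : ‖F p‖ ≤ ‖F‖ :=
  (F.le_supNorm p).trans (le_add_of_nonneg_left (lipConst_nonneg _ _))

theorem LipMaps.lipConst_le_norm (F : LipMaps G ϑ) : lipConst ϑ (F : EdgePath G → ℂ) ≤ ‖F‖ :=
  le_add_of_nonneg_right (supNorm_nonneg _)

theorem LipMaps.sub_apply (F F' : LipMaps G ϑ) (p : EdgePath G) :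
    (F - F' : LipMaps G ϑ) p = F p - F' p := by
  rw [map_sub, Pi.sub_apply]

/-- The limit is taken pointwise; sup and Lipschitz bounds on differences are closed conditions and
pass to it. -/
theorem LipMaps.completeSpace (h0 : 0 ≤ ϑ) : CompleteSpace (LipMaps G ϑ) := by
  refine Metric.complete_of_cauchySeq_tendsto fun u hu => ?_
  have hpt : ∀ p, ∃ a : ℂ, Tendsto (fun n => u n p) atTop (𝓝 a) := by
    intro p
    refine cauchySeq_tendsto_of_complete (Metric.cauchySeq_iff.2 fun ε hε => ?_)
    obtain ⟨N, hN⟩ := Metric.cauchySeq_iff.1 hu ε hε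
    refine ⟨N, fun m hm n hn => lt_of_le_of_lt ?_ (hN m hm n hn)⟩
    rw [dist_eq_norm, dist_eq_norm, ← LipMaps.sub_apply]
    exact LipMaps.norm_apply_le _ p
  choose F hF using hpt
  have hsup : ∀ ε, ∀ N, (∀ m ≥ N, ∀ n ≥ N, dist (u m) (u n) ≤ ε) →
      ∀ n ≥ N, ∀ p, ‖F p - u n p‖ ≤ ε := by
    intro ε N h n hn p
    refine le_of_tendsto ((hF p).sub_const (u n p)).norm
      (eventually_atTop.2 ⟨N, fun m hm => ?_⟩)
    rw [← LipMaps.sub_apply]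
    exact (LipMaps.norm_apply_le _ p).trans (dist_eq_norm (u m) (u n) ▸ h m hm n hn)
  have hlip : ∀ ε, ∀ N, (∀ m ≥ N, ∀ n ≥ N, dist (u m) (u n) ≤ ε) →
      ∀ n ≥ N, LipOnDistricts ϑ ε (F - LipMaps.toFun (u n)) := by
    intro ε N h n hn p q hpq
    refine le_of_tendsto (((hF p).sub_const (u n p)).sub ((hF q).sub_const (u n q))).norm
      (eventually_atTop.2 ⟨N, fun m hm => ?_⟩)
    rw [← LipMaps.sub_apply, ← LipMaps.sub_apply]
    exact (LipMaps.lipOnDistricts _ p q hpq).trans (mul_le_mul_of_nonneg_right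
      ((LipMaps.lipConst_le_norm _).trans (dist_eq_norm (u m) (u n) ▸ h m hm n hn))
      (pathDist_nonneg h0 p q))
  have hcau : ∀ ε > 0, ∃ N, ∀ m ≥ N, ∀ n ≥ N, dist (u m) (u n) ≤ ε := fun ε hε => by
    obtain ⟨N, hN⟩ := Metric.cauchySeq_iff.1 hu ε hε
    exact ⟨N, fun m hm n hn => (hN m hm n hn).le⟩
  have hmem : ∀ ε, ∀ N, (∀ m ≥ N, ∀ n ≥ N, dist (u m) (u n) ≤ ε) →
      ∀ n ≥ N, F - LipMaps.toFun (u n) ∈ lipSubmodule G ϑ := fun ε N h n hn =>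
    mem_lipSubmodule h0 (hsup ε N h n hn) (hlip ε N h n hn)
  obtain ⟨N₁, hN₁⟩ := hcau 1 one_pos
  have hFmem : F ∈ lipSubmodule G ϑ := by
    have := (lipSubmodule G ϑ).add_mem (hmem 1 N₁ hN₁ N₁ le_rfl) (u N₁).2
    exact (sub_add_cancel F (u N₁ : EdgePath G → ℂ)) ▸ this
  obtain ⟨F', rfl⟩ : ∃ F' : LipMaps G ϑ, LipMaps.toFun F' = F := ⟨⟨F, hFmem⟩, rfl⟩
  refine ⟨F', Metric.tendsto_atTop.2 fun ε hε => ?_⟩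
  obtain ⟨N, hN⟩ := hcau (ε / 3) (by positivity)
  refine ⟨N, fun n hn => ?_⟩
  rw [dist_comm, dist_eq_norm]
  have := LipMaps.norm_le (F := F' - u n) (B := ε / 3) (C := ε / 3)
    (by positivity) (by positivity) (hsup _ N hN n hn) (hlip _ N hN n hn)
  linarith

end LipMaps

/-! ### Norms of the iterated transfer operator -/

section Transfer

variable {V : Type*} [Fintype V] [DecidableEq V] {G : SimpleGraph V} [DecidableRel G.Adj] {ϑ : ℝ}

theorem sum_turn_subtype {M : Type*} [AddCommMonoid M] (e : G.Dart) (φ : G.Dart → M) :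
    ∑ e' : {e' : G.Dart // Turn e' e}, φ e'.1 = ∑ e' : G.Dart with Turn e' e, φ e' :=
  (Finset.sum_subtype (Finset.univ.filter fun e' : G.Dart => Turn e' e) (by simp) φ).symm

theorem transfer_apply (F : EdgePath G → ℂ) (p : EdgePath G) :
    transfer G F p = ∑ e : {e : G.Dart // Turn e (p.edge 0)}, F (p.cons e.1 e.2) := rfl

/-- Transports the index type, so that two paths with the same first edge are summed over the same
extensions. -/
theorem transfer_apply_of_edge_eq (F : EdgePath G → ℂ) {p : EdgePath G} {e₀ : G.Dart}
    (h : p.edge 0 = e₀) :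
    transfer G F p = ∑ e : {e : G.Dart // Turn e e₀}, F (p.cons e.1 (h.symm ▸ e.2)) := by
  subst h
  rfl

/-- The transfer operator acts on functions of the first edge as the turn sum operator. -/
theorem transfer_comp_edge_zero (φ : G.Dart → ℂ) (p : EdgePath G) :
    transfer G (fun p => φ (p.edge 0)) p = turnSum G φ (p.edge 0) :=
  sum_turn_subtype (p.edge 0) φ

theorem norm_transfer_le {F : EdgePath G → ℂ} {c : G.Dart → ℝ} (h : ∀ p, ‖F p‖ ≤ c (p.edge 0))
    (p : EdgePath G) : ‖transfer G F p‖ ≤ ∑ e : G.Dart with Turn e (p.edge 0), c e := by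
  rw [← sum_turn_subtype]
  exact (norm_sum_le _ _).trans (Finset.sum_le_sum fun e _ => h _)

/-- Extensions of `p` and `q` by the same edge are compared termwise. The constant `c` may vary with
the first edge so that iteration reproduces the recursion of the path counts. -/
theorem norm_transfer_sub_le {F : EdgePath G → ℂ} {c : G.Dart → ℝ}
    (h : ∀ p q, p.edge 0 = q.edge 0 → ‖F p - F q‖ ≤ c (p.edge 0) * pathDist ϑ p q)
    (p q : EdgePath G) (hpq : p.edge 0 = q.edge 0) :
    ‖transfer G F p - transfer G F q‖ ≤
      (∑ e : G.Dart with Turn e (p.edge 0), c e) * (ϑ * pathDist ϑ p q) := by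
  have hq : transfer G F q =
      ∑ e : {e : G.Dart // Turn e (p.edge 0)}, F (q.cons e.1 (hpq ▸ e.2)) :=
    transfer_apply_of_edge_eq F hpq.symm
  rw [hq, transfer_apply, ← Finset.sum_sub_distrib, ← sum_turn_subtype, Finset.sum_mul]
  refine (norm_sum_le _ _).trans (Finset.sum_le_sum fun e _ => ?_)
  rw [← pathDist_cons ϑ e.1 e.2 (hpq ▸ e.2)]
  exact h _ _ rfl

theorem norm_transfer_iterate_le {F : EdgePath G → ℂ} {B : ℝ} (hB : ∀ p, ‖F p‖ ≤ B) (m : ℕ)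
    (p : EdgePath G) : ‖(transfer G ^ m) F p‖ ≤ pileHeightAt G m (p.edge 0) * B := by
  induction m generalizing p with
  | zero => simpa [pileHeightAt_zero] using hB p
  | succ m ih =>
    rw [pow_succ', Module.End.mul_apply, pileHeightAt_succ, Nat.cast_sum, Finset.sum_mul]
    exact norm_transfer_le (c := fun e => pileHeightAt G m e * B) ih p

theorem norm_transfer_iterate_sub_le {F : EdgePath G → ℂ} {C : ℝ} (hC : LipOnDistricts ϑ C F)
    (m : ℕ) (p q : EdgePath G) (hpq : p.edge 0 = q.edge 0) :
    ‖(transfer G ^ m) F p - (transfer G ^ m) F q‖ ≤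
      (pileHeightAt G m (p.edge 0) * ϑ ^ m * C) * pathDist ϑ p q := by
  induction m generalizing p q with
  | zero => simpa [pileHeightAt_zero] using hC p q hpq
  | succ m ih =>
    rw [pow_succ', Module.End.mul_apply, pileHeightAt_succ]
    refine (norm_transfer_sub_le (c := fun e => pileHeightAt G m e * ϑ ^ m * C) ih p q hpq).trans
      (le_of_eq ?_)
    push_cast
    rw [← Finset.sum_mul, ← Finset.sum_mul]
    ring

theorem transfer_iterate_one (m : ℕ) (p : EdgePath G) :
    (transfer G ^ m) (fun _ => (1 : ℂ)) p = pileHeightAt G m (p.edge 0) := by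
  induction m generalizing p with
  | zero => simp [pileHeightAt_zero]
  | succ m ih =>
    rw [pow_succ', Module.End.mul_apply, funext ih,
      transfer_comp_edge_zero (fun e => (pileHeightAt G m e : ℂ)), pileHeightAt_succ, Nat.cast_sum]
    rfl

theorem LipMaps.lipOnDistricts_transfer_iterate (h0 : 0 ≤ ϑ) (F : LipMaps G ϑ) (m : ℕ) :
    LipOnDistricts ϑ (pileHeight G m * ϑ ^ m * lipConst ϑ (F : EdgePath G → ℂ))
      ((transfer G ^ m) F) := by
  intro p q hpq
  refine (norm_transfer_iterate_sub_le F.lipOnDistricts m p q hpq).trans ?_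
  have := pathDist_nonneg h0 p q
  have := lipConst_nonneg ϑ (F : EdgePath G → ℂ)
  have : (pileHeightAt G m (p.edge 0) : ℝ) ≤ pileHeight G m :=
    mod_cast pileHeightAt_le_pileHeight G m _
  gcongr

theorem LipMaps.norm_transfer_iterate_le (F : LipMaps G ϑ) (m : ℕ) (p : EdgePath G) :
    ‖(transfer G ^ m) F p‖ ≤ pileHeight G m * supNorm (F : EdgePath G → ℂ) := by
  refine (SpectralGraph.norm_transfer_iterate_le F.le_supNorm m p).trans ?_
  have := supNorm_nonneg (F : EdgePath G → ℂ)
  have : (pileHeightAt G m (p.edge 0) : ℝ) ≤ pileHeight G m :=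
    mod_cast pileHeightAt_le_pileHeight G m _
  gcongr

theorem LipMaps.transfer_mem (h0 : 0 ≤ ϑ) (F : LipMaps G ϑ) : transfer G F ∈ lipSubmodule G ϑ := by
  have h := mem_lipSubmodule h0 (F.norm_transfer_iterate_le 1)
    (F.lipOnDistricts_transfer_iterate h0 1)
  rwa [pow_one] at h

/-- The transfer operator as a linear endomorphism of the space of Lipschitz functions. -/
noncomputable def lipTransferₗ (h0 : 0 ≤ ϑ) : Module.End ℂ (LipMaps G ϑ) where
  toFun F := ⟨transfer G F, F.transfer_mem h0⟩
  map_add' F F' := LipMaps.ext fun p => by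
    change transfer G (LipMaps.toFun (F + F')) p = transfer G F p + transfer G F' p
    rw [map_add, map_add, Pi.add_apply]
  map_smul' c F := LipMaps.ext fun p => by
    change transfer G (LipMaps.toFun (c • F)) p = c * transfer G F p
    rw [map_smul, map_smul, Pi.smul_apply, smul_eq_mul]

theorem lipTransferₗ_pow_apply (h0 : 0 ≤ ϑ) (m : ℕ) (F : LipMaps G ϑ) :
    ((lipTransferₗ h0 ^ m) F : EdgePath G → ℂ) = (transfer G ^ m) F := by
  induction m with
  | zero => rfl
  | succ m ih =>
    rw [pow_succ', pow_succ', Module.End.mul_apply, Module.End.mul_apply, ← ih]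
    rfl

theorem norm_lipTransferₗ_pow_le (h0 : 0 ≤ ϑ) (h1 : ϑ ≤ 1) (m : ℕ) (F : LipMaps G ϑ) :
    ‖(lipTransferₗ h0 ^ m) F‖ ≤ pileHeight G m * ‖F‖ := by
  have hL := lipConst_nonneg ϑ (F : EdgePath G → ℂ)
  have hS := supNorm_nonneg (F : EdgePath G → ℂ)
  refine (LipMaps.norm_le (B := pileHeight G m * supNorm (F : EdgePath G → ℂ))
    (C := pileHeight G m * ϑ ^ m * lipConst ϑ (F : EdgePath G → ℂ)) (by positivity)
    (by positivity) ?_ ?_).trans ?_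
  · rw [lipTransferₗ_pow_apply]
    exact F.norm_transfer_iterate_le m
  · rw [lipTransferₗ_pow_apply]
    exact F.lipOnDistricts_transfer_iterate h0 m
  · rw [LipMaps.norm_def, mul_add]
    gcongr
    exact mul_le_of_le_one_right (Nat.cast_nonneg _) (pow_le_one₀ h0 h1)

/-- The transfer operator as a bounded operator on the space of Lipschitz functions. -/
noncomputable def lipTransfer (h0 : 0 ≤ ϑ) (h1 : ϑ ≤ 1) : LipMaps G ϑ →L[ℂ] LipMaps G ϑ :=
  (lipTransferₗ h0).mkContinuous (pileHeight G 1) fun F => by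
    simpa using norm_lipTransferₗ_pow_le h0 h1 1 F

theorem lipTransfer_pow_apply (h0 : 0 ≤ ϑ) (h1 : ϑ ≤ 1) (m : ℕ) (F : LipMaps G ϑ) :
    (lipTransfer h0 h1 ^ m) F = (lipTransferₗ h0 ^ m) F := by
  induction m with
  | zero => rfl
  | succ m ih =>
    rw [pow_succ', pow_succ', mul_apply_eq_comp, Module.End.mul_apply, ih]
    rfl

theorem lipTransfer_apply (h0 : 0 ≤ ϑ) (h1 : ϑ ≤ 1) (F : LipMaps G ϑ) :
    (lipTransfer h0 h1 F : EdgePath G → ℂ) = transfer G F := rfl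

/-- The lower bound tests on the constant function 1, whose image under the `m`-th iterate is the
path count at the first edge, evaluated at a path whose first edge maximizes that count. -/
theorem norm_lipTransfer_pow [Nonempty G.Dart] (hdeg : ∀ v, 2 ≤ G.degree v) (h0 : 0 ≤ ϑ)
    (h1 : ϑ ≤ 1) (m : ℕ) : ‖(lipTransfer h0 h1 : LipMaps G ϑ →L[ℂ] _) ^ m‖ = pileHeight G m := by
  refine le_antisymm (ContinuousLinearMap.opNorm_le_bound _ (Nat.cast_nonneg _) fun F => ?_) ?_
  · rw [lipTransfer_pow_apply]
    exact norm_lipTransferₗ_pow_le h0 h1 m F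
  · obtain ⟨e, -, he⟩ := Finset.exists_mem_eq_sup (Finset.univ : Finset G.Dart)
      Finset.univ_nonempty (pileHeightAt G m)
    obtain ⟨p, hp⟩ := exists_edgePath hdeg e
    have hlip : LipOnDistricts ϑ 0 (fun _ : EdgePath G => (1 : ℂ)) := fun p q _ => by simp
    have hone : ‖LipMaps.mk' h0 (fun _ : EdgePath G => (1 : ℂ)) (B := 1) (by simp) hlip‖ ≤ 1 := by
      simpa using LipMaps.norm_le zero_le_one le_rfl
        (F := LipMaps.mk' h0 (fun _ : EdgePath G => (1 : ℂ)) (B := 1) (by simp) hlip)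
        (by simp) hlip
    refine le_trans ?_ (((lipTransfer h0 h1 ^ m).le_of_opNorm_le_of_le le_rfl hone).trans
      (mul_one _).le)
    refine le_trans (le_of_eq ?_) (LipMaps.norm_apply_le _ p)
    rw [lipTransfer_pow_apply, lipTransferₗ_pow_apply]
    have := transfer_iterate_one (G := G) m p
    rw [hp] at this
    refine Eq.trans ?_ (congrArg norm this).symm
    rw [Complex.norm_natCast, pileHeight, he]

end Transfer

/-! ### Spectral theory modulo an invariant finite-dimensional subspace -/

section Banach

variable {E : Type*} [NormedAddCommGroup E] [NormedSpace ℂ E] {T Q : E →L[ℂ] E} {μ : ℂ}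

/-- The inner factors `Q` are absorbed. The exponent is positive because the power zero gives the
identity instead of `Q`. -/
theorem pow_succ_mul_of_mul_mul_eq (hQT : Q * T * Q = Q * T) (m : ℕ) :
    (Q * T) ^ (m + 1) = Q * T ^ (m + 1) := by
  induction m with
  | zero => simp
  | succ m ih => rw [pow_succ', ih, ← mul_assoc, hQT, mul_assoc, ← pow_succ']

/-- By induction `Q` kills `(T - μ) x`. Since `Q T x = Q T Q x`, this says that `μ - Q T` kills `Q
x`, and that operator is invertible. -/
theorem apply_eq_zero_of_pow_sub_apply_eq_zero (hQT : Q * T * Q = Q * T)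
    (hμ : μ ∉ spectrum ℂ (Q * T)) (k : ℕ) (x : E)
    (hx : (((T : Module.End ℂ E) - algebraMap ℂ _ μ) ^ k) x = 0) : Q x = 0 := by
  induction k generalizing x with
  | zero =>
    have : x = 0 := by simpa using hx
    rw [this, map_zero]
  | succ k ih =>
    rw [pow_succ, Module.End.mul_apply] at hx
    have h1 : Q (T x - μ • x) = 0 := by
      simpa [Module.algebraMap_end_apply] using ih _ hx
    have h2 : (algebraMap ℂ (E →L[ℂ] E) μ - Q * T) (Q x) = 0 := by
      have h3 : Q (T (Q x)) = Q (T x) := DFunLike.congr_fun hQT x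
      rw [map_sub, map_smul, sub_eq_zero] at h1
      simp [Algebra.algebraMap_eq_smul_one, h3, h1]
    obtain ⟨u, hu⟩ := spectrum.notMem_iff.1 hμ
    rw [← hu] at h2
    have h4 : (↑u⁻¹ * ↑u : E →L[ℂ] E) (Q x) = 0 := by
      rw [mul_apply_eq_comp, h2, map_zero]
    simpa using h4

theorem maxGenEigenspace_le_ker (hQT : Q * T * Q = Q * T) (hμ : μ ∉ spectrum ℂ (Q * T)) :
    Module.End.maxGenEigenspace (T : Module.End ℂ E) μ ≤ LinearMap.ker (Q : E →ₗ[ℂ] E) := by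
  intro x hx
  obtain ⟨k, hk⟩ := (Module.End.mem_maxGenEigenspace _ _ _).1 hx
  exact apply_eq_zero_of_pow_sub_apply_eq_zero hQT hμ k x
    (by rwa [Algebra.algebraMap_eq_smul_one])

/-- Let `Q` be a projection with finite-dimensional kernel invariant under `T`. A point of the
spectrum of `T` outside the spectrum of the operator `Q T` is an eigenvalue. -/
theorem hasEigenvalue_of_mem_spectrum [CompleteSpace E] (hQ : Q * Q = Q)
    (hQT : Q * T * Q = Q * T) [FiniteDimensional ℂ (LinearMap.ker (Q : E →ₗ[ℂ] E))]
    (hμ : μ ∉ spectrum ℂ (Q * T)) (hT : μ ∈ spectrum ℂ T) :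
    Module.End.HasEigenvalue (T : Module.End ℂ E) μ := by
  by_contra hev
  have hinj : ∀ x, μ • x - T x = 0 → x = 0 := by
    intro x hx
    by_contra hx0
    exact hev (Module.End.hasEigenvalue_of_hasEigenvector
      ⟨Module.End.mem_eigenspace_iff.2 (sub_eq_zero.1 hx).symm, hx0⟩)
  have hQQ : ∀ x, Q (Q x) = Q x := fun x => DFunLike.congr_fun hQ x
  have hQTQ : ∀ x, Q (T (Q x)) = Q (T x) := fun x => DFunLike.congr_fun hQT x
  set K := LinearMap.ker (Q : E →ₗ[ℂ] E)
  have hK : ∀ x ∈ K, (μ • LinearMap.id - (T : E →ₗ[ℂ] E) : E →ₗ[ℂ] E) x ∈ K := by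
    intro x hx
    have hx : Q x = 0 := hx
    change Q (μ • x - T x) = 0
    rw [map_sub, map_smul, hx, ← hQTQ, hx]
    simp
  -- On the finite-dimensional invariant space `K`, injectivity suffices.
  have hsurjK : Function.Surjective ((μ • LinearMap.id - (T : E →ₗ[ℂ] E) : E →ₗ[ℂ] E).restrict hK) := by
    refine LinearMap.injective_iff_surjective.1 ((injective_iff_map_eq_zero _).2 fun x hx => ?_)
    exact Subtype.ext (hinj x (congrArg Subtype.val hx))
  refine spectrum.mem_iff.1 hT (ContinuousLinearMap.isUnit_iff_bijective.2 ⟨?_, ?_⟩)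
  · refine (injective_iff_map_eq_zero _).2 fun x hx => hinj x ?_
    simpa [Algebra.algebraMap_eq_smul_one] using hx
  · intro y
    -- Solve the equation modulo `K` by inverting `μ - Q T`; the remaining error lies in `K` and is
    -- corrected by `x₂`.
    obtain ⟨x₁, hx₁⟩ := (ContinuousLinearMap.isUnit_iff_bijective.1
      (spectrum.notMem_iff.1 hμ)).2 (Q y)
    have hx₁ : μ • x₁ - Q (T x₁) = Q y := by
      simpa [Algebra.algebraMap_eq_smul_one] using hx₁
    have hker : y - (μ • x₁ - T x₁) ∈ K := by
      change Q (y - (μ • x₁ - T x₁)) = 0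
      have h := congrArg Q hx₁
      rw [map_sub, hQQ, hQQ] at h
      rw [map_sub, map_sub, h, sub_self]
    obtain ⟨x₂, hx₂⟩ := hsurjK ⟨_, hker⟩
    have hx₂ : μ • (x₂ : E) - T x₂ = y - (μ • x₁ - T x₁) := congrArg Subtype.val hx₂
    refine ⟨x₁ + x₂, ?_⟩
    have : μ • (x₁ + x₂ : E) - T (x₁ + x₂) = y := by
      rw [smul_add, map_add, add_sub_add_comm, hx₂, add_sub_cancel]
    simpa [Algebra.algebraMap_eq_smul_one] using this

/-- A point of the spectrum is bounded by the growth rate of the powers, where bounds on the norms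
are allowed to be off by a constant factor. -/
theorem notMem_spectrum_of_norm_pow_le [CompleteSpace E] {A : E →L[ℂ] E} {R : ℕ → ℝ}
    {c ϑ ρ : ℝ} (hc : 0 ≤ c) (hϑ : 0 < ϑ) (hR : ∀ m, 0 ≤ R m)
    (hρ : Tendsto (fun m : ℕ => R m ^ (1 / (m : ℝ))) atTop (𝓝 ρ))
    (hA : ∀ m, ‖A ^ (m + 1)‖ ≤ c * (R (m + 1) * ϑ ^ (m + 1))) (hμ : ϑ * ρ < ‖μ‖) :
    μ ∉ spectrum ℂ A := by
  intro hmem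
  have hρ0 : 0 ≤ ρ := ge_of_tendsto' hρ fun m => Real.rpow_nonneg (hR m) _
  have hμ0 : 0 < ‖μ‖ := lt_of_le_of_lt (by positivity) hμ
  -- With `r` strictly between, eventually `R m ≤ r ^ m`, while `c * (ϑ * r) ^ m` is eventually
  -- below `‖μ‖ ^ m`; this contradicts `‖μ‖ ^ m ≤ ‖A ^ m‖`.
  obtain ⟨r, hr1, hr2⟩ : ∃ r, ρ < r ∧ r < ‖μ‖ / ϑ :=
    exists_between ((lt_div_iff₀ hϑ).2 (by rwa [mul_comm]))
  have hr0 : 0 ≤ r := hρ0.trans hr1.le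
  have hs : ϑ * r / ‖μ‖ < 1 := by
    rw [div_lt_one hμ0, mul_comm]
    exact (lt_div_iff₀ hϑ).1 hr2
  have hlim : Tendsto (fun m : ℕ => c * (ϑ * r / ‖μ‖) ^ m) atTop (𝓝 0) := by
    simpa using (tendsto_pow_atTop_nhds_zero_of_lt_one (by positivity) hs).const_mul c
  obtain ⟨m, ⟨hm1, hm2⟩, hm0⟩ := (((hρ.eventually_lt_const hr1).and
    (hlim.eventually_lt_const one_pos)).and (eventually_gt_atTop 0)).exists
  obtain ⟨k, rfl⟩ : ∃ k, m = k + 1 := ⟨m - 1, by omega⟩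
  have hRr : R (k + 1) ≤ r ^ (k + 1) := by
    have h := pow_le_pow_left₀ (Real.rpow_nonneg (hR _) _) hm1.le (k + 1)
    rwa [one_div, Real.rpow_inv_natCast_pow (hR _) hm0.ne'] at h
  have h1 : ‖μ‖ ^ (k + 1) ≤ ‖A ^ (k + 1)‖ := by
    rw [← norm_pow]
    refine (spectrum.norm_le_norm_mul_of_mem (spectrum.pow_mem_pow A (k + 1) hmem)).trans ?_
    exact mul_le_of_le_one_right (norm_nonneg _) ContinuousLinearMap.norm_id_le
  have h2 : c * (R (k + 1) * ϑ ^ (k + 1)) < ‖μ‖ ^ (k + 1) := by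
    calc c * (R (k + 1) * ϑ ^ (k + 1)) ≤ c * (r ^ (k + 1) * ϑ ^ (k + 1)) := by gcongr
      _ = c * (ϑ * r / ‖μ‖) ^ (k + 1) * ‖μ‖ ^ (k + 1) := by
        rw [div_pow, mul_pow]
        field_simp
      _ < 1 * ‖μ‖ ^ (k + 1) := by gcongr
      _ = _ := one_mul _
  linarith [hA k]

end Banach

/-! ### Functions of the first edge and the projection along them -/

section FirstEdge

variable {V : Type*} [Fintype V] {G : SimpleGraph V} [DecidableRel G.Adj] {ϑ : ℝ}

theorem exists_norm_le_of_dart [DecidableEq V] (φ : G.Dart → ℂ) : ∃ B, ∀ e, ‖φ e‖ ≤ B :=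
  ⟨∑ e, ‖φ e‖, fun e => Finset.single_le_sum (f := fun e => ‖φ e‖) (fun _ _ => norm_nonneg _)
    (Finset.mem_univ e)⟩

variable [DecidableEq V]

/-- Functions of edges as functions of paths that depend on the first edge only. -/
noncomputable def ofFirstEdge (h0 : 0 ≤ ϑ) : (G.Dart → ℂ) →ₗ[ℂ] LipMaps G ϑ where
  toFun φ := LipMaps.mk' h0 (fun p => φ (p.edge 0)) (B := (exists_norm_le_of_dart φ).choose)
    (C := 0) (fun p => (exists_norm_le_of_dart φ).choose_spec _) fun p q h => by simp [h]
  map_add' _ _ := rfl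
  map_smul' _ _ := rfl

@[simp] theorem ofFirstEdge_apply (h0 : 0 ≤ ϑ) (φ : G.Dart → ℂ) (p : EdgePath G) :
    (ofFirstEdge h0 φ : LipMaps G ϑ) p = φ (p.edge 0) := rfl

theorem ofFirstEdge_injective (h0 : 0 ≤ ϑ) (hdeg : ∀ v, 2 ≤ G.degree v) :
    Function.Injective (ofFirstEdge h0 : (G.Dart → ℂ) →ₗ[ℂ] LipMaps G ϑ) := by
  intro φ φ' h
  funext e
  obtain ⟨p, rfl⟩ := exists_edgePath hdeg e
  rw [← ofFirstEdge_apply h0 φ p, h, ofFirstEdge_apply]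

theorem exists_ofFirstEdge_eq (h0 : 0 ≤ ϑ) (hdeg : ∀ v, 2 ≤ G.degree v) {F : LipMaps G ϑ}
    (hF : F ∈ dependsOn G ϑ 1) : ∃ φ, ofFirstEdge h0 φ = F := by
  choose rep hrep using exists_edgePath hdeg
  refine ⟨fun e => F (rep e), LipMaps.ext fun p => hF _ _ fun i hi => ?_⟩
  obtain rfl : i = 0 := by omega
  exact hrep _

theorem finiteDimensional_dependsOn_one (h0 : 0 ≤ ϑ) (hdeg : ∀ v, 2 ≤ G.degree v) :
    FiniteDimensional ℂ (dependsOn G ϑ 1) := by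
  refine Submodule.finiteDimensional_of_le (S₂ := LinearMap.range (ofFirstEdge h0)) fun F hF => ?_
  exact exists_ofFirstEdge_eq h0 hdeg hF

theorem lipTransfer_ofFirstEdge (h0 : 0 ≤ ϑ) (h1 : ϑ ≤ 1) (φ : G.Dart → ℂ) :
    lipTransfer h0 h1 (ofFirstEdge h0 φ : LipMaps G ϑ) = ofFirstEdge h0 (turnSum G φ) :=
  LipMaps.ext fun p => transfer_comp_edge_zero φ p

/-- Given a path through every edge, subtract from a function its value at the chosen path with the
same first edge. -/
noncomputable def subFirstEdgeₗ (h0 : 0 ≤ ϑ) (rep : G.Dart → EdgePath G) :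
    Module.End ℂ (LipMaps G ϑ) :=
  LinearMap.id - ofFirstEdge h0 ∘ₗ LinearMap.funLeft ℂ ℂ rep ∘ₗ LipMaps.toFun

theorem subFirstEdgeₗ_apply (h0 : 0 ≤ ϑ) (rep : G.Dart → EdgePath G) (F : LipMaps G ϑ)
    (p : EdgePath G) : subFirstEdgeₗ h0 rep F p = F p - F (rep (p.edge 0)) :=
  LipMaps.sub_apply _ _ _

/-- A path and its representative share a first edge, so their distance is at most 1; the subtracted
term is constant on districts. The bound involves the Lipschitz constant alone, the part of the norm
that contracts. -/
theorem norm_subFirstEdgeₗ_le (h0 : 0 ≤ ϑ) (h1 : ϑ ≤ 1) {rep : G.Dart → EdgePath G}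
    (hrep : ∀ e, (rep e).edge 0 = e) (F : LipMaps G ϑ) :
    ‖subFirstEdgeₗ h0 rep F‖ ≤ 2 * lipConst ϑ (F : EdgePath G → ℂ) := by
  have hL := lipConst_nonneg ϑ (F : EdgePath G → ℂ)
  rw [two_mul]
  refine LipMaps.norm_le hL hL (fun p => ?_) fun p q hpq => ?_
  · rw [subFirstEdgeₗ_apply]
    exact (F.lipOnDistricts _ _ (hrep _).symm).trans
      (mul_le_of_le_one_right hL (pathDist_le_one h0 h1 _ _))
  · rw [subFirstEdgeₗ_apply, subFirstEdgeₗ_apply, hpq, sub_sub_sub_cancel_right]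
    exact F.lipOnDistricts p q hpq

/-- `subFirstEdgeₗ` as a bounded operator. -/
noncomputable def subFirstEdge (h0 : 0 ≤ ϑ) (h1 : ϑ ≤ 1) {rep : G.Dart → EdgePath G}
    (hrep : ∀ e, (rep e).edge 0 = e) : LipMaps G ϑ →L[ℂ] LipMaps G ϑ :=
  (subFirstEdgeₗ h0 rep).mkContinuous 2 fun F => (norm_subFirstEdgeₗ_le h0 h1 hrep F).trans
    (mul_le_mul_of_nonneg_left F.lipConst_le_norm zero_le_two)

section

variable (h0 : 0 ≤ ϑ) (h1 : ϑ ≤ 1) {rep : G.Dart → EdgePath G} (hrep : ∀ e, (rep e).edge 0 = e)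

theorem subFirstEdge_apply (F : LipMaps G ϑ) :
    subFirstEdge h0 h1 hrep F = F - ofFirstEdge h0 fun e => F (rep e) := rfl

theorem subFirstEdge_ofFirstEdge (φ : G.Dart → ℂ) :
    subFirstEdge h0 h1 hrep (ofFirstEdge h0 φ) = 0 := by
  rw [subFirstEdge_apply, sub_eq_zero]
  congr 1
  funext e
  rw [ofFirstEdge_apply, hrep]

theorem subFirstEdge_mul_self :
    subFirstEdge h0 h1 hrep * subFirstEdge h0 h1 hrep = subFirstEdge h0 h1 hrep := by
  ext1 F
  rw [mul_apply_eq_comp, subFirstEdge_apply h0 h1 hrep F, map_sub, subFirstEdge_ofFirstEdge,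
    sub_zero, subFirstEdge_apply h0 h1 hrep F]

/-- The complement of the projection lands in functions of the first edge, which the transfer
operator preserves and the projection kills. -/
theorem subFirstEdge_mul_lipTransfer_mul :
    subFirstEdge h0 h1 hrep * lipTransfer h0 h1 * subFirstEdge h0 h1 hrep =
      subFirstEdge h0 h1 hrep * lipTransfer h0 h1 := by
  ext1 F
  rw [mul_apply_eq_comp, mul_apply_eq_comp, mul_apply_eq_comp, subFirstEdge_apply h0 h1 hrep F,
    map_sub, lipTransfer_ofFirstEdge, map_sub, subFirstEdge_ofFirstEdge, sub_zero]

theorem ker_subFirstEdge_le :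
    LinearMap.ker (subFirstEdge h0 h1 hrep : LipMaps G ϑ →ₗ[ℂ] LipMaps G ϑ) ≤ dependsOn G ϑ 1 := by
  intro F hF p q hpq
  have hF : F = ofFirstEdge h0 fun e => F (rep e) := sub_eq_zero.1 hF
  rw [hF, ofFirstEdge_apply, ofFirstEdge_apply, hpq 0 one_pos]

theorem norm_subFirstEdge_mul_pow_le (m : ℕ) :
    ‖subFirstEdge h0 h1 hrep * lipTransfer h0 h1 ^ m‖ ≤ 2 * (pileHeight G m * ϑ ^ m) := by
  refine ContinuousLinearMap.opNorm_le_bound _ (by positivity) fun F => ?_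
  have hlip : lipConst ϑ ((lipTransfer h0 h1 ^ m) F : EdgePath G → ℂ) ≤
      pileHeight G m * ϑ ^ m * lipConst ϑ (F : EdgePath G → ℂ) := by
    have := lipConst_nonneg ϑ (F : EdgePath G → ℂ)
    refine lipConst_le (by positivity) ?_
    rw [lipTransfer_pow_apply, lipTransferₗ_pow_apply]
    exact F.lipOnDistricts_transfer_iterate h0 m
  calc ‖subFirstEdge h0 h1 hrep ((lipTransfer h0 h1 ^ m) F)‖
      ≤ 2 * lipConst ϑ ((lipTransfer h0 h1 ^ m) F : EdgePath G → ℂ) :=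
        norm_subFirstEdgeₗ_le h0 h1 hrep _
    _ ≤ 2 * (pileHeight G m * ϑ ^ m * lipConst ϑ (F : EdgePath G → ℂ)) := by gcongr
    _ ≤ 2 * (pileHeight G m * ϑ ^ m * ‖F‖) := by gcongr; exact F.lipConst_le_norm
    _ = _ := by ring

end

/-- The eigenvectors of the turn sum operator, seen as functions of paths, are exactly the
eigenvectors of the transfer operator that depend on the first edge only. -/
theorem exists_eigenspace_turnSum_equiv (h0 : 0 ≤ ϑ) (h1 : ϑ ≤ 1) (hdeg : ∀ v, 2 ≤ G.degree v)
    {μ : ℂ} (hμ : Module.End.eigenspace (lipTransfer (G := G) h0 h1 : Module.End ℂ (LipMaps G ϑ)) μ ≤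
      dependsOn G ϑ 1) :
    ∃ Φ : Module.End.eigenspace (turnSum G) μ ≃ₗ[ℂ]
        Module.End.eigenspace (lipTransfer (G := G) h0 h1 : Module.End ℂ (LipMaps G ϑ)) μ,
      ∀ (φ : Module.End.eigenspace (turnSum G) μ) (p : EdgePath G),
        (Φ φ : LipMaps G ϑ) p = (φ : G.Dart → ℂ) (p.edge 0) := by
  have hmem : ∀ φ : G.Dart → ℂ, ofFirstEdge h0 φ ∈
      Module.End.eigenspace (lipTransfer (G := G) h0 h1 : Module.End ℂ (LipMaps G ϑ)) μ ↔
      φ ∈ Module.End.eigenspace (turnSum G) μ := by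
    intro φ
    rw [Module.End.mem_eigenspace_iff, Module.End.mem_eigenspace_iff,
      ContinuousLinearMap.coe_coe, lipTransfer_ofFirstEdge, ← map_smul]
    exact (ofFirstEdge_injective h0 hdeg).eq_iff
  refine ⟨LinearEquiv.ofBijective ((ofFirstEdge h0).restrict fun φ hφ => (hmem φ).2 hφ)
    ⟨fun φ φ' h => ?_, fun F => ?_⟩, fun φ p => rfl⟩
  · exact Subtype.ext (ofFirstEdge_injective h0 hdeg (congrArg Subtype.val h))
  · obtain ⟨φ, hφ⟩ := exists_ofFirstEdge_eq h0 hdeg (hμ F.2)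
    exact ⟨⟨φ, (hmem φ).1 (hφ ▸ F.2)⟩, Subtype.ext hφ⟩

end FirstEdge

/-! ### From edge eigenvectors to vertex functions -/

section Vertices

variable {V : Type*} [Fintype V] {G : SimpleGraph V} [DecidableRel G.Adj] {μ : ℂ}

theorem eqLocus_neighborSum_eq :
    LinearMap.eqLocus (neighborSum G) (rescale G μ) =
      LinearMap.eqLocus (neighborAvg G) (localTweak G μ) := by
  ext f
  rw [LinearMap.mem_eqLocus, LinearMap.mem_eqLocus, funext_iff, funext_iff]
  refine forall_congr' fun v => ?_
  have hq : (1 + (modDegree G v : ℂ)) ≠ 0 := by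
    rw [add_comm]
    exact Nat.cast_add_one_ne_zero _
  change neighborSum G f v = (μ + (modDegree G v : ℂ) * μ⁻¹) * f v ↔
    1 / (1 + (modDegree G v : ℂ)) * neighborSum G f v =
      (μ + μ⁻¹ * (modDegree G v : ℂ)) / (1 + (modDegree G v : ℂ)) * f v
  rw [one_div_mul_eq_div, div_mul_eq_mul_div, div_left_inj' hq, mul_comm μ⁻¹]

/-- Vanishing along an edge and along its reversal gives `(μ² - 1) f v = 0`. -/
theorem eq_zero_of_gradient_eq_zero (hdeg : ∀ v, 2 ≤ G.degree v) (hμ : μ ≠ 0) (hμ1 : μ ≠ 1)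
    (hμ2 : μ ≠ -1) {f : V → ℂ} (h : gradient G μ f = 0) : f = 0 := by
  funext v
  obtain ⟨w, hw⟩ := (G.degree_pos_iff_exists_adj v).1 (by have := hdeg v; omega)
  have h1 : f v - μ⁻¹ * f w = 0 := congrFun h ⟨(v, w), hw⟩
  have h2 : f w - μ⁻¹ * f v = 0 := congrFun h ⟨(w, v), hw.symm⟩
  have h3 : (μ - 1) * (μ + 1) * f v = 0 := by
    field_simp at h1 h2
    linear_combination μ * h1 + h2
  have h4 : μ + 1 ≠ 0 := fun h => hμ2 (eq_neg_of_add_eq_zero_left h)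
  simpa [sub_eq_zero, hμ1, h4] using h3

variable [DecidableEq V]

theorem turnSum_add_symm (φ : G.Dart → ℂ) (e : G.Dart) :
    turnSum G φ e + φ e.symm = ∑ e' : G.Dart with e'.snd = e.fst, φ e' :=
  sum_turn_add_symm e φ

/-- The value of `f` at the end of `e` enters once through the omitted reversal and once through `μ`
times the gradient. The twist `μ⁻¹` makes the two cancel, leaving only a vertex term. -/
theorem turnSum_gradient_sub (hdeg : ∀ v, 2 ≤ G.degree v) (hμ : μ ≠ 0) (f : V → ℂ) (e : G.Dart) :
    turnSum G (gradient G μ f) e - μ * gradient G μ f e =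
      neighborSum G f e.fst - rescale G μ f e.fst := by
  have h1 : ∑ e' : G.Dart with e'.snd = e.fst, gradient G μ f e' =
      neighborSum G f e.fst - (modDegree G e.fst + 1) * (μ⁻¹ * f e.fst) := by
    have h2 : ∑ e' : G.Dart with e'.snd = e.fst, gradient G μ f e' =
        ∑ e' : G.Dart with e'.snd = e.fst, (f e'.fst - μ⁻¹ * f e.fst) :=
      Finset.sum_congr rfl fun e' he' => by
        rw [gradient, (Finset.mem_filter.1 he').2]
    rw [h2, sum_filter_snd e.fst fun w => f w - μ⁻¹ * f e.fst, Finset.sum_sub_distrib,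
      Finset.sum_const, SimpleGraph.card_neighborFinset_eq_degree, ← modDegree_add_one hdeg,
      nsmul_eq_mul]
    push_cast
    rfl
  rw [← turnSum_add_symm, ← eq_sub_iff_add_eq] at h1
  have h3 : rescale G μ f e.fst = (μ + (modDegree G e.fst : ℂ) * μ⁻¹) * f e.fst := rfl
  have h4 : gradient G μ f e.symm = f e.snd - μ⁻¹ * f e.fst := rfl
  rw [h1, h3, h4, gradient]
  field_simp
  ring

theorem gradient_mem_eigenspace_iff (hdeg : ∀ v, 2 ≤ G.degree v) (hμ : μ ≠ 0) (f : V → ℂ) :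
    gradient G μ f ∈ Module.End.eigenspace (turnSum G) μ ↔
      f ∈ LinearMap.eqLocus (neighborSum G) (rescale G μ) := by
  rw [Module.End.mem_eigenspace_iff, LinearMap.mem_eqLocus, funext_iff, funext_iff]
  constructor
  · intro h v
    obtain ⟨w, hw⟩ := (G.degree_pos_iff_exists_adj v).1 (by have := hdeg v; omega)
    have h' := turnSum_gradient_sub hdeg hμ f ⟨(v, w), hw⟩
    rw [h, Pi.smul_apply, smul_eq_mul, sub_self] at h'
    exact sub_eq_zero.1 h'.symm
  · intro h e
    have h' := turnSum_gradient_sub hdeg hμ f e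
    rw [h, sub_self] at h'
    exact sub_eq_zero.1 h'

theorem exists_gradient_eq (hμ : μ ≠ 0) (hμ1 : μ ≠ 1) (hμ2 : μ ≠ -1) {φ : G.Dart → ℂ}
    (hφ : φ ∈ Module.End.eigenspace (turnSum G) μ) : ∃ f, gradient G μ f = φ := by
  have h4 : μ + 1 ≠ 0 := fun h => hμ2 (eq_neg_of_add_eq_zero_left h)
  have h5 : μ - 1 ≠ 0 := sub_ne_zero.2 hμ1
  have hsum : ∀ e : G.Dart, ∑ e' : G.Dart with e'.snd = e.fst, φ e' = μ * φ e + φ e.symm := by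
    intro e
    rw [← turnSum_add_symm, Module.End.mem_eigenspace_iff.1 hφ, Pi.smul_apply, smul_eq_mul]
  -- With `g v` the sum of `φ` over edges ending at `v`, one has `μ φ(e) + φ(e.symm) = g e.fst` and
  -- the same for `e.symm`. Eliminating `φ(e.symm)` gives `(μ² - 1) φ(e) = μ g e.fst - g e.snd`.
  refine ⟨fun v => (∑ e' : G.Dart with e'.snd = v, φ e') * (μ / ((μ - 1) * (μ + 1))), ?_⟩
  funext e
  have h6 := hsum e.symm
  rw [SimpleGraph.Dart.symm_symm] at h6
  change _ * _ - μ⁻¹ * ((∑ e' : G.Dart with e'.snd = e.symm.fst, φ e') * _) = _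
  rw [hsum e, h6]
  field_simp
  ring

/-- Away from `μ = ±1`, the gradient identifies the solutions of the vertex equation with the
eigenvectors of the turn sum operator. -/
theorem exists_eqLocus_equiv (hdeg : ∀ v, 2 ≤ G.degree v) (hμ : μ ≠ 0) (hμ1 : μ ≠ 1)
    (hμ2 : μ ≠ -1) :
    ∃ Γ : LinearMap.eqLocus (neighborSum G) (rescale G μ) ≃ₗ[ℂ]
        Module.End.eigenspace (turnSum G) μ,
      ∀ f : LinearMap.eqLocus (neighborSum G) (rescale G μ),
        (Γ f : G.Dart → ℂ) = gradient G μ (f : V → ℂ) := by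
  let grad : (V → ℂ) →ₗ[ℂ] (G.Dart → ℂ) :=
    { toFun := gradient G μ
      map_add' := fun f f' => by ext e; simp [gradient]; ring
      map_smul' := fun c f => by ext e; simp [gradient]; ring }
  refine ⟨LinearEquiv.ofBijective
    (grad.restrict fun f hf => (gradient_mem_eigenspace_iff hdeg hμ f).2 hf) ⟨?_, ?_⟩,
    fun f => rfl⟩
  · refine (injective_iff_map_eq_zero _).2 fun f hf => Subtype.ext ?_
    exact eq_zero_of_gradient_eq_zero hdeg hμ hμ1 hμ2 (congrArg Subtype.val hf)
  · rintro ⟨φ, hφ⟩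
    obtain ⟨f, rfl⟩ := exists_gradient_eq hμ hμ1 hμ2 hφ
    exact ⟨⟨f, (gradient_mem_eigenspace_iff hdeg hμ f).1 hφ⟩, rfl⟩

end Vertices

/-! ### Existence of the growth rate -/

section SpectralRadius

variable {V : Type*} [Fintype V] [DecidableEq V] {G : SimpleGraph V} [DecidableRel G.Adj] {ϑ : ℝ}

theorem LipMaps.nontrivial [Nonempty G.Dart] (h0 : 0 ≤ ϑ) (hdeg : ∀ v, 2 ≤ G.degree v) :
    Nontrivial (LipMaps G ϑ) :=
  (ofFirstEdge_injective h0 hdeg).nontrivial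

theorem tendsto_ofReal_pileHeight [Nonempty G.Dart] (hdeg : ∀ v, 2 ≤ G.degree v) (h0 : 0 ≤ ϑ)
    (h1 : ϑ ≤ 1) :
    Tendsto (fun m : ℕ => ENNReal.ofReal ((pileHeight G m : ℝ) ^ (1 / (m : ℝ)))) atTop
      (𝓝 (spectralRadius ℂ (lipTransfer h0 h1 : LipMaps G ϑ →L[ℂ] LipMaps G ϑ))) := by
  have := LipMaps.completeSpace (G := G) h0
  simpa only [norm_lipTransfer_pow hdeg] using
    spectrum.pow_norm_pow_one_div_tendsto_nhds_spectralRadius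
      (lipTransfer h0 h1 : LipMaps G ϑ →L[ℂ] LipMaps G ϑ)

/-- Spectral mapping gives a bound for each single `m`, which the limit alone does not; the case of
equality needs it. -/
theorem spectralRadius_lipTransfer_pow_le [Nonempty G.Dart] (hdeg : ∀ v, 2 ≤ G.degree v)
    (h0 : 0 ≤ ϑ) (h1 : ϑ ≤ 1) (m : ℕ) :
    spectralRadius ℂ (lipTransfer h0 h1 : LipMaps G ϑ →L[ℂ] LipMaps G ϑ) ^ m ≤ pileHeight G m := by
  have := LipMaps.completeSpace (G := G) h0
  have := LipMaps.nontrivial (G := G) h0 hdeg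
  refine (spectrum.spectralRadius_pow_le' _ m).trans
    ((spectrum.spectralRadius_le_nnnorm _).trans (le_of_eq ?_))
  have h : ‖(lipTransfer h0 h1 : LipMaps G ϑ →L[ℂ] LipMaps G ϑ) ^ m‖₊ = (pileHeight G m : NNReal) :=
    NNReal.eq (norm_lipTransfer_pow hdeg h0 h1 m)
  rw [h, ENNReal.coe_natCast]

theorem exists_tendsto_pileHeight [Nonempty G.Dart] (hdeg : ∀ v, 2 ≤ G.degree v) :
    ∃ ρ : ℝ, Tendsto (fun m : ℕ => (pileHeight G m : ℝ) ^ (1 / (m : ℝ))) atTop (𝓝 ρ) ∧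
      ∀ m, ρ ^ m ≤ pileHeight G m := by
  -- Any parameter in the unit interval would do: the counts do not involve it.
  have h0 : (0 : ℝ) ≤ 1 / 2 := by norm_num
  have h1 : (1 / 2 : ℝ) ≤ 1 := by norm_num
  have hle := spectralRadius_lipTransfer_pow_le (G := G) hdeg h0 h1
  set r := spectralRadius ℂ (lipTransfer h0 h1 : LipMaps G (1 / 2) →L[ℂ] LipMaps G (1 / 2))
  have hr : r ≠ ⊤ := by
    have h := hle 1
    rw [pow_one] at h
    exact ne_top_of_le_ne_top (ENNReal.natCast_ne_top _) h
  refine ⟨r.toReal, ?_, fun m => ?_⟩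
  · refine ((ENNReal.tendsto_toReal hr).comp (tendsto_ofReal_pileHeight hdeg h0 h1)).congr
      fun m => ENNReal.toReal_ofReal (by positivity)
  · rw [← ENNReal.toReal_pow, ← ENNReal.toReal_natCast]
    exact ENNReal.toReal_mono (ENNReal.natCast_ne_top _) (hle m)

end SpectralRadius

end SpectralGraph

/-! ### The main theorem -/

theorem mainTheorem1 {V : Type*} [Fintype V] [DecidableEq V] (G : SimpleGraph V)
    [DecidableRel G.Adj] (hconn : G.Connected) (hdeg : ∀ v, 2 ≤ G.degree v) :
    ∃ ρ : ℝ,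
      Tendsto (fun m : ℕ => (pileHeight G m : ℝ) ^ (1 / (m : ℝ))) atTop (𝓝 ρ) ∧
      ρ ≤ maxModDegree G ∧
      (ρ = maxModDegree G ↔ ∃ d, G.IsRegularOfDegree d) ∧
      ∀ ϑ : ℝ, 0 < ϑ → ϑ < 1 →
        ∃ T : LipMaps G ϑ →L[ℂ] LipMaps G ϑ,
          (∀ F : LipMaps G ϑ, (T F : EdgePath G → ℂ) = transfer G F) ∧
          Tendsto (fun m : ℕ => ‖T ^ m‖ ^ (1 / (m : ℝ))) atTop (𝓝 ρ) ∧
          spectralRadius ℂ T = ENNReal.ofReal ρ ∧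
          ∀ μ ∈ spectrum ℂ T, ϑ * ρ < ‖μ‖ →
            Module.End.HasEigenvalue (T : Module.End ℂ (LipMaps G ϑ)) μ ∧
            FiniteDimensional ℂ
              (Module.End.maxGenEigenspace (T : Module.End ℂ (LipMaps G ϑ)) μ) ∧
            Module.End.eigenspace (T : Module.End ℂ (LipMaps G ϑ)) μ ≤ dependsOn G ϑ 1 ∧
            (∃ Φ : Module.End.eigenspace (turnSum G) μ ≃ₗ[ℂ]
                Module.End.eigenspace (T : Module.End ℂ (LipMaps G ϑ)) μ,
              ∀ (φ : Module.End.eigenspace (turnSum G) μ) (p : EdgePath G),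
                (Φ φ : LipMaps G ϑ) p = (φ : G.Dart → ℂ) (p.edge 0)) ∧
            (μ ≠ 1 → μ ≠ -1 →
              ∃ Ψ : LinearMap.eqLocus (neighborSum G) (rescale G μ) ≃ₗ[ℂ]
                  Module.End.eigenspace (T : Module.End ℂ (LipMaps G ϑ)) μ,
                ∀ (f : LinearMap.eqLocus (neighborSum G) (rescale G μ)) (p : EdgePath G),
                  (Ψ f : LipMaps G ϑ) p = gradient G μ (f : V → ℂ) (p.edge 0)) ∧
            LinearMap.eqLocus (neighborSum G) (rescale G μ) =
              LinearMap.eqLocus (neighborAvg G) (localTweak G μ) := by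
  have := nonempty_dart hconn hdeg
  obtain ⟨ρ, hρ, hpow⟩ := exists_tendsto_pileHeight (G := G) hdeg
  have hρ0 : 0 ≤ ρ := ge_of_tendsto' hρ fun m => by positivity
  have hle : ρ ≤ maxModDegree G := by
    refine le_of_pow_le_pow_left₀ one_ne_zero (Nat.cast_nonneg _) ((hpow 1).trans ?_)
    exact_mod_cast pileHeight_le_pow G 1
  refine ⟨ρ, hρ, hle, ⟨fun h => ?_, fun ⟨d, hd⟩ => ?_⟩, fun ϑ hϑ0 hϑ1 => ?_⟩
  · refine ⟨_, isRegular_of_pow_le_pileHeight G hconn hdeg fun m => ?_⟩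
    have := hpow m
    rw [h] at this
    exact_mod_cast this
  · refine tendsto_nhds_unique hρ (tendsto_const_nhds.congr' ?_)
    -- At `m = 0` the exponent `1 / 0` is 0 and the root is 1, so the sequence is constant only from
    -- `m = 1` on.
    filter_upwards [eventually_ne_atTop 0] with m hm
    rw [pileHeight_eq_pow_of_isRegular G hd, Nat.cast_pow, one_div,
      Real.pow_rpow_inv_natCast (Nat.cast_nonneg _) hm]
  have h0 := hϑ0.le
  have h1 := hϑ1.le
  have := LipMaps.completeSpace (G := G) h0
  have := finiteDimensional_dependsOn_one (G := G) h0 hdeg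
  refine ⟨lipTransfer h0 h1, lipTransfer_apply h0 h1, ?_, ?_, fun μ hμ hμρ => ?_⟩
  · simpa only [norm_lipTransfer_pow hdeg] using hρ
  · exact tendsto_nhds_unique (tendsto_ofReal_pileHeight hdeg h0 h1) (ENNReal.tendsto_ofReal hρ)
  choose rep hrep using exists_edgePath (G := G) hdeg
  have hμ0 : μ ≠ 0 := norm_pos_iff.1 (lt_of_le_of_lt (by positivity) hμρ)
  have hQT := subFirstEdge_mul_lipTransfer_mul h0 h1 hrep
  have hker := ker_subFirstEdge_le h0 h1 hrep
  have hfin := Submodule.finiteDimensional_of_le hker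
  -- The powers of the compressed operator are bounded by `2 * R_m * ϑ ^ m`; the factor 2 disappears
  -- in the `m`-th root.
  have hnot : μ ∉ spectrum ℂ (subFirstEdge h0 h1 hrep * lipTransfer h0 h1) := by
    refine notMem_spectrum_of_norm_pow_le zero_le_two hϑ0 (fun m => Nat.cast_nonneg _) hρ
      (fun m => ?_) hμρ
    rw [pow_succ_mul_of_mul_mul_eq hQT]
    exact norm_subFirstEdge_mul_pow_le h0 h1 hrep (m + 1)
  have hgen := (maxGenEigenspace_le_ker hQT hnot).trans hker
  have heig : Module.End.eigenspace (lipTransfer (G := G) h0 h1 : Module.End ℂ (LipMaps G ϑ)) μ ≤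
      dependsOn G ϑ 1 := (Module.End.genEigenspace _ μ).mono le_top |>.trans hgen
  obtain ⟨Φ, hΦ⟩ := exists_eigenspace_turnSum_equiv h0 h1 hdeg heig
  refine ⟨hasEigenvalue_of_mem_spectrum (subFirstEdge_mul_self h0 h1 hrep) hQT hnot hμ,
    Submodule.finiteDimensional_of_le hgen, heig, ⟨Φ, hΦ⟩, fun hμ1 hμ2 => ?_,
    eqLocus_neighborSum_eq⟩
  obtain ⟨Γ, hΓ⟩ := exists_eqLocus_equiv (G := G) hdeg hμ0 hμ1 hμ2
  exact ⟨Γ.trans Φ, fun f p => by rw [LinearEquiv.trans_apply, hΦ, hΓ]⟩
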